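/- Consider $N$ qubits on a line, labelled $1,\dots,N$, with Pauli matrices $X_i,Y_i,Z_i$ (in the standard convention $Z|0\rangle=|0\rangle$, $Z|1\rangle=-|1\rangle$, $Y|0\rangle=\mathrm i|1\rangle$), and the domino Hamiltonian $$H_{\rm do}=\frac12\sum_{i=2}^{N-1}X_i(1-Z_{i-1}Z_{i+1}).$$ For $T>0$ let $|\psi_{\rm do}\rangle=\mathrm e^{-\mathrm iTH_{\rm do}}|+\rangle_1\otimes|0\cdots0\rangle$ be the one-domain-wall domino state, and let $a_i=\langle 1_i|\mathrm e^{-\mathrm iTH_{\rm do}}|1_1\rangle$ for $1\le i\le N$, where $|1_i\rangle$ has $1$ on the first $i$ qubits and $0$ on the others. Sensing: $\rho_\theta=\mathcal N_\theta^{\otimes N}(|\psi_{\rm do}\rangle\langle\psi_{\rm do}|)$, where $\mathcal N_\theta$ $(\theta\in\mathbb R)$ is a family of one-qubit quantum channels, differentiable in $\theta$, that is a noisy version of the noiseless rotation $\mathcal U_\theta(\sigma)=\mathrm e^{-\mathrm i\theta Z}\sigma\,\mathrm e^{\mathrm i\theta Z}$ with noise parameter $p\ge0$: for a fixed constant $K>0$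 and all $\theta$, $\|\mathcal N_\theta-\mathcal U_\theta\|_\diamond\le Kp$ and $\|\partial_\theta(\mathcal N_\theta-\mathcal U_\theta)\|_\diamond\le Kp$. (Dephasing, $\mathcal N_\theta(\sigma)=(1-p)\,\mathcal U_\theta(\sigma)+p\,Z\,\mathcal U_\theta(\sigma)\,Z$, is the case $K=4$.) Let $\theta_{\rm pr}\in\mathbb R$ (the prior estimate of $\theta$). By redefining each $|1\rangle_j$ with an extra phase, one can choose a rotated on-site basis in which the amplitudes satisfy $\mathrm{Arg}(a_i)=-\frac{\pi}{2}(1-i)-2\theta_{\rm pr}i$ modulo $2\pi$ for all $i$ with $a_i\ne0$. For a velocity $v>0$, define with the Pauli matrices $Y_j$ of any such rotated basis $$\mathcal O_{\rm do}=\sum_{vT/2\le i\le 2vT}|a_i|\,Y_1\otimes\cdots\otimes Y_i .$$ Claim. For all constants $v,c_{\rm do},K>0$ there are constants $c_{\rm no},c_{\rm pr},c_1,c_2>0$, depending only on $v,c_{\rm do},K$, such that for all $N$, $T>0$, $p\ge 0$, $\theta,\theta_{\rm pr}$ and all families $\mathcal N_\theta$ as above: if $$\sum_{vT/2\le i\le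 2vT}|a_i|^2\ge c_{\rm do},\qquad p\le\frac{c_{\rm no}}{vT},\qquad |\theta-\theta_{\rm pr}|\le\frac{c_{\rm pr}}{vT}$$ (sums over integers $1\le i\le N$ in the given range), then a rotated basis as above exists, and for each such basis $\langle\mathcal O_{\rm do}\rangle_{\rho_\theta}=\mathrm{tr}(\rho_\theta\mathcal O_{\rm do})$ is differentiable in $\theta$, its variance $\langle\Delta\mathcal O_{\rm do}^2\rangle_{\rho_\theta}=\langle\mathcal O_{\rm do}^2\rangle_{\rho_\theta}-\langle\mathcal O_{\rm do}\rangle_{\rho_\theta}^2$ is positive, and $$c_1T^2\le\frac{\left(\partial_\theta\langle\mathcal O_{\rm do}\rangle_{\rho_\theta}\right)^2}{\langle\Delta\mathcal O_{\rm do}^2\rangle_{\rho_\theta}}\le c_2T^2 .$$ -/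

import Mathlib

open scoped ComplexOrder

namespace DominoMetrology

noncomputable section

/-- Operators on one qubit; index `0` is the ket `|0⟩` and index `1` is the ket `|1⟩`. -/
abbrev QubitOp : Type := Matrix (Fin 2) (Fin 2) ℂ

/-- Linear maps acting on one-qubit operators. -/
abbrev SuperOp : Type := QubitOp →ₗ[ℂ] QubitOp

/-- Computational basis labels of a chain of `N` qubits. Site number `n` (with `1 ≤ n ≤ N`) is
the coordinate `j : Fin N` with `j + 1 = n`. -/
abbrev Config (N : ℕ) : Type := Fin N → Fin 2

/-- Operators on the chain of `N` qubits. -/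
abbrev ChainOp (N : ℕ) : Type := Matrix (Config N) (Config N) ℂ

/-! ### Pauli matrices and tensor products -/

def pauliX : QubitOp := !![0, 1; 1, 0]

def pauliY : QubitOp := !![0, -Complex.I; Complex.I, 0]

def pauliZ : QubitOp := !![1, 0; 0, -1]

/-- The tensor product `⨂_j A_j` as an operator on the chain. -/
def tensorOp {N : ℕ} (A : Fin N → QubitOp) : ChainOp N :=
  Matrix.of fun x y => ∏ j, A j (x j) (y j)

/-- The operator `A` on site number `n` (sites are numbered `1, …, N`), identity elsewhere. -/
def onSite (N n : ℕ) (A : QubitOp) : ChainOp N :=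
  tensorOp fun j => if (j : ℕ) + 1 = n then A else 1

/-! ### The domino dynamics -/

/-- `H = (1/2) ∑_{i=2}^{N-1} X_i (1 - Z_{i-1} Z_{i+1})`. -/
def dominoH (N : ℕ) : ChainOp N :=
  (1 / 2 : ℂ) • ∑ i ∈ Finset.Icc 2 (N - 1),
    onSite N i pauliX * (1 - onSite N (i - 1) pauliZ * onSite N (i + 1) pauliZ)

/-- The time evolution `exp (-i T H)`. -/
def dominoU (N : ℕ) (T : ℝ) : ChainOp N :=
  NormedSpace.exp ((-Complex.I * (T : ℂ)) • dominoH N)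

/-- The configuration with `1` on the first `i` qubits and `0` on the rest. -/
def wallConfig (N i : ℕ) : Config N := fun j => if (j : ℕ) + 1 ≤ i then 1 else 0

/-- The initial state `|+⟩₁ ⊗ |0 ⋯ 0⟩`. -/
def initialState (N : ℕ) : Config N → ℂ := fun x =>
  ∏ j : Fin N, if (j : ℕ) = 0 then ((Real.sqrt 2)⁻¹ : ℂ) else if x j = 0 then 1 else 0

/-- The one-domain-wall domino state `exp (-i T H) (|+⟩₁ ⊗ |0 ⋯ 0⟩)`. -/
def dominoState (N : ℕ) (T : ℝ) : Config N → ℂ := (dominoU N T).mulVec (initialState N)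

/-- The density matrix of the domino state. -/
def dominoRho (N : ℕ) (T : ℝ) : ChainOp N :=
  Matrix.vecMulVec (dominoState N T) (star (dominoState N T))

/-- The amplitude `a_i = ⟨1_i| exp (-i T H) |1_1⟩`. -/
def amp (N : ℕ) (T : ℝ) (i : ℕ) : ℂ := dominoU N T (wallConfig N i) (wallConfig N 1)

/-- The integers `1 ≤ i ≤ N` with `vT/2 ≤ i ≤ 2vT`. -/
def window (N : ℕ) (v T : ℝ) : Finset ℕ :=
  (Finset.Icc 1 N).filter fun i => v * T / 2 ≤ (i : ℝ) ∧ (i : ℝ) ≤ 2 * v * T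

/-! ### The rotated on-site basis and the observable -/

/-- The on-site change of basis `|0⟩ ↦ |0⟩`, `|1⟩ ↦ |1'⟩ = e^{iφ} |1⟩`. -/
def phaseGate (φ : ℝ) : QubitOp := Matrix.diagonal ![1, Complex.exp (Complex.I * φ)]

/-- The Pauli matrix `Y` of the rotated basis, `-i |0⟩⟨1'| + i |1'⟩⟨0|`. -/
def rotY (φ : ℝ) : QubitOp := phaseGate φ * pauliY * (phaseGate φ).conjTranspose

/-- The amplitude `⟨1'_i| exp (-i T H) |1_1⟩` of the evolved state in the rotated basis, where
site `j` is rotated by the phase `φ j` and hence `|1'_i⟩ = e^{i (φ 1 + ⋯ + φ i)} |1_i⟩`. -/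
def rotAmp (N : ℕ) (T : ℝ) (φ : ℕ → ℝ) (i : ℕ) : ℂ :=
  Complex.exp (-Complex.I * ((∑ j ∈ Finset.Icc 1 i, φ j : ℝ) : ℂ)) * amp N T i

/-- In the basis rotated by `φ`, the argument of the `i`-th amplitude is
`-(π/2)(1 - i) - 2 θpr i` modulo `2π` (no condition when the amplitude vanishes). -/
def IsAligned (N : ℕ) (T θpr : ℝ) (φ : ℕ → ℝ) : Prop :=
  ∀ i ∈ Finset.Icc 1 N, rotAmp N T φ i =
    (‖amp N T i‖ : ℂ) *
      Complex.exp (Complex.I * ((-(Real.pi / 2) * (1 - (i : ℝ)) - 2 * θpr * (i : ℝ) : ℝ) : ℂ))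

/-- The string `Y_1 ⊗ ⋯ ⊗ Y_i` in the basis rotated by `φ`. -/
def rotYString (N : ℕ) (φ : ℕ → ℝ) (i : ℕ) : ChainOp N :=
  tensorOp fun j => if (j : ℕ) + 1 ≤ i then rotY (φ ((j : ℕ) + 1)) else 1

/-- The observable `∑_{vT/2 ≤ i ≤ 2vT} |a_i| Y_1 ⊗ ⋯ ⊗ Y_i` in the basis rotated by `φ`. -/
def dominoO (N : ℕ) (v T : ℝ) (φ : ℕ → ℝ) : ChainOp N :=
  ∑ i ∈ window N v T, (‖amp N T i‖ : ℂ) • rotYString N φ i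

/-! ### Channels, diamond norm, noise -/

/-- The trace norm (sum of the singular values). -/
def traceNorm {ι : Type*} [Fintype ι] [DecidableEq ι] (A : Matrix ι ι ℂ) : ℝ :=
  ∑ k, Real.sqrt ((Matrix.isHermitian_conjTranspose_mul_self A).eigenvalues k)

/-- `Φ ⊗ id` on one qubit and an `n`-dimensional ancilla. -/
def withAncilla (Φ : SuperOp) (n : ℕ) (X : Matrix (Fin 2 × Fin n) (Fin 2 × Fin n) ℂ) :
    Matrix (Fin 2 × Fin n) (Fin 2 × Fin n) ℂ :=
  Matrix.of fun a b => Φ (Matrix.of fun i j => X (i, a.2) (j, b.2)) a.1 b.1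

/-- The diamond norm, with values in `[0, ∞]`. -/
def diamondNorm (Φ : SuperOp) : ENNReal :=
  ⨆ (n : ℕ) (X : Matrix (Fin 2 × Fin n) (Fin 2 × Fin n) ℂ) (_ : traceNorm X ≤ 1),
    ENNReal.ofReal (traceNorm (withAncilla Φ n X))

/-- Quantum channels: completely positive trace-preserving maps. -/
structure IsChannel (Φ : SuperOp) : Prop where
  completely_positive : ∀ (n : ℕ) (X : Matrix (Fin 2 × Fin n) (Fin 2 × Fin n) ℂ),
    X.PosSemidef → (withAncilla Φ n X).PosSemidef
  trace_preserving : ∀ X : QubitOp, (Φ X).trace = X.trace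

/-- `exp (-i θ Z)`. -/
def phaseRot (θ : ℝ) : QubitOp :=
  Matrix.diagonal ![Complex.exp (-Complex.I * θ), Complex.exp (Complex.I * θ)]

/-- The noiseless sensing channel `ρ ↦ exp (-i θ Z) ρ exp (i θ Z)`. -/
def idealSensing (θ : ℝ) : SuperOp :=
  (LinearMap.mulLeft ℂ (phaseRot θ)).comp (LinearMap.mulRight ℂ (phaseRot θ).conjTranspose)

/-- `D` is the derivative at `θ` of the family `Φ` of linear maps. -/
def HasSuperDerivAt (Φ : ℝ → SuperOp) (D : SuperOp) (θ : ℝ) : Prop :=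
  ∀ (X : QubitOp) (i j : Fin 2), HasDerivAt (fun t => Φ t X i j) (D X i j) θ

/-- A noisy version of the sensing channel: a differentiable family of channels whose deviation
from the noiseless family, and the `θ`-derivative of this deviation, have diamond norm at most
`K p`, where `p` is the noise parameter. -/
structure IsNoisySensing (K p : ℝ) (𝒩 : ℝ → SuperOp) : Prop where
  channel : ∀ θ, IsChannel (𝒩 θ)
  close : ∀ θ, diamondNorm (𝒩 θ - idealSensing θ) ≤ ENNReal.ofReal (K * p)
  deriv_close : ∀ θ, ∃ D : SuperOp, HasSuperDerivAt (fun t => 𝒩 t - idealSensing t) D θ ∧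
    diamondNorm D ≤ ENNReal.ofReal (K * p)

/-- The tensor power `Φ^{⊗N}`: the linear map that sends the product `⨂_j |u_j⟩⟨w_j|` to
`⨂_j Φ(|u_j⟩⟨w_j|)`. -/
def tensorPower (N : ℕ) (Φ : SuperOp) (ρ : ChainOp N) : ChainOp N :=
  ∑ u : Config N, ∑ w : Config N,
    ρ u w • tensorOp fun j => Φ (Matrix.single (u j) (w j) 1)

/-! ### Error-propagation sensitivity -/

/-- `⟨A⟩_ρ = tr (ρ A)`. -/
def expect {N : ℕ} (ρ A : ChainOp N) : ℝ := (ρ * A).trace.re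

/-- `⟨ΔA²⟩_ρ = ⟨A²⟩_ρ - ⟨A⟩_ρ²`. -/
def variance {N : ℕ} (ρ A : ChainOp N) : ℝ := expect ρ (A * A) - expect ρ A ^ 2

/-- `(∂_θ ⟨A⟩_{ρ_θ})² / ⟨ΔA²⟩_{ρ_θ}`. -/
def sensitivity {N : ℕ} (ρ : ℝ → ChainOp N) (A : ChainOp N) (θ : ℝ) : ℝ :=
  deriv (fun t => expect (ρ t) A) θ ^ 2 / variance (ρ θ) A

/-- The domino state after sensing through the channels `𝒩 θ` on every qubit. -/
def sensedRho (N : ℕ) (T : ℝ) (𝒩 : ℝ → SuperOp) (θ : ℝ) : ChainOp N :=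
  tensorPower N (𝒩 θ) (dominoRho N T)

end

end DominoMetrology

open DominoMetrology

/-! The `i`-th term of `dominoH` flips site `i` only when its two neighbours differ, so the wall
configurations `1, …, N` span an invariant space and the all-zero configuration is annihilated.
Hence √2 times the evolved state is the sum of the wall `0` with amplitude 1 and the walls `k ≥ 1`
with amplitudes `a_k` (`dominoState_eq`).

Without noise, a `Y` string on the sites `s+1, …, e` connects only the walls `s` and `e`, since
these differ exactly on those sites. The aligned phases leave only the angle `2(θ - θpr)(e - s)`,
shifted by `-π/2` when `s = 0` (`wallPhase_sub_add_stringPhase`). The mean is therefore `∑ |a_e|²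
sin(2(θ - θpr)e)`, whose slope near `θpr` is of order `vT`. Since `Y² = 1`, the square of the
observable is `∑ |a_i|²` plus twice a weighted sum of strings between window walls, which contribute
nonnegative cosines. So the variance stays between positive constants while the mean is small.

Noise perturbs each string factor by at most `δ = 4Kp`, while factors off the string are exact by
trace preservation. On the delimiting pair of walls the relative error is about `(1 + δ)^(e - s) -
1`, small because `e ≤ 2vT` and `p = O(1/(vT))`. Any other pair inside the string pays one `δ` per
string site where the two bits agree. A Schur test (`sum_strict_kernel_le`, `sum_stringWeight_le`)
sums all these pairs and strings to `O(δ)` uniformly in `N`. The `θ`-derivative obeys the same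
estimates with an extra factor of order `vT`. `abs_weighted_sum_sub_le` packages the comparison for
the mean, the second moment and the slope. -/

/-! ### Trace norm, diamond norm and matrix entries -/

open Matrix in
lemma DominoMetrology.sum_eigenvalues_conjTranspose_mul_self {ι : Type*} [Fintype ι] [DecidableEq ι]
    (A : Matrix ι ι ℂ) :
    ∑ k, (isHermitian_conjTranspose_mul_self A).eigenvalues k = ∑ i, ∑ j, ‖A i j‖ ^ 2 := by
  have h := (isHermitian_conjTranspose_mul_self A).trace_eq_sum_eigenvalues
  have h2 : (Aᴴ * A).trace = ((∑ i, ∑ j, ‖A i j‖ ^ 2 : ℝ) : ℂ) := by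
    rw [Finset.sum_comm]
    simp only [Matrix.trace, Matrix.diag, Matrix.mul_apply, Matrix.conjTranspose_apply]
    push_cast
    refine Finset.sum_congr rfl fun i _ => Finset.sum_congr rfl fun j _ => ?_
    simpa using Complex.conj_mul' (A j i)
  rw [h2] at h
  have h3 := congrArg Complex.re h
  simp only [Complex.ofReal_re] at h3
  rw [h3]
  simp

-- An entry is at most the Frobenius norm, which is the ℓ² norm of the singular values and so at
-- most their ℓ¹ norm.
open Matrix in
lemma DominoMetrology.norm_entry_le_traceNorm {ι : Type*} [Fintype ι] [DecidableEq ι]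
    (A : Matrix ι ι ℂ) (i j : ι) : ‖A i j‖ ≤ traceNorm A := by
  have hnn : ∀ k, 0 ≤ (isHermitian_conjTranspose_mul_self A).eigenvalues k :=
    fun k => (posSemidef_conjTranspose_mul_self A).eigenvalues_nonneg k
  refine abs_le_of_sq_le_sq' ?_ (Finset.sum_nonneg fun _ _ => Real.sqrt_nonneg _) |>.2
  calc ‖A i j‖ ^ 2 ≤ ∑ j, ‖A i j‖ ^ 2 :=
        Finset.single_le_sum (f := fun j => ‖A i j‖ ^ 2) (fun _ _ => by positivity)
          (Finset.mem_univ j)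
    _ ≤ ∑ i, ∑ j, ‖A i j‖ ^ 2 :=
        Finset.single_le_sum (f := fun i => ∑ j, ‖A i j‖ ^ 2) (fun _ _ => by positivity)
          (Finset.mem_univ i)
    _ = ∑ k, (Real.sqrt ((isHermitian_conjTranspose_mul_self A).eigenvalues k)) ^ 2 := by
        rw [← sum_eigenvalues_conjTranspose_mul_self]
        exact Finset.sum_congr rfl fun k _ => (Real.sq_sqrt (hnn k)).symm
    _ ≤ (traceNorm A) ^ 2 :=
        Finset.sum_sq_le_sq_sum_of_nonneg fun _ _ => Real.sqrt_nonneg _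

namespace DominoMetrology

open Matrix in
/-- Half a matrix unit has trace norm at most one. -/
lemma traceNorm_half_unit_le (u w : Fin 2) :
    traceNorm (Matrix.of fun a b : Fin 2 × Fin 1 =>
      (Matrix.single u w (1 / 2 : ℂ)) a.1 b.1) ≤ 1 := by
  set A : Matrix (Fin 2 × Fin 1) (Fin 2 × Fin 1) ℂ :=
    Matrix.of fun a b : Fin 2 × Fin 1 => (Matrix.single u w (1 / 2 : ℂ)) a.1 b.1 with hA
  have hs := sum_eigenvalues_conjTranspose_mul_self A
  have hnn : ∀ k, 0 ≤ (isHermitian_conjTranspose_mul_self A).eigenvalues k :=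
    fun k => (posSemidef_conjTranspose_mul_self A).eigenvalues_nonneg k
  have hv : ∑ i, ∑ j, ‖A i j‖ ^ 2 = 1 / 4 := by
    simp only [hA, Fintype.sum_prod_type]
    fin_cases u <;> fin_cases w <;> simp [Matrix.single] <;> norm_num
  rw [hv] at hs
  have hk : ∀ k, Real.sqrt ((isHermitian_conjTranspose_mul_self A).eigenvalues k) ≤ 1 / 2 := by
    intro k
    refine Real.sqrt_le_iff.2 ⟨by norm_num, ?_⟩
    have := Finset.single_le_sum (fun k _ => hnn k) (Finset.mem_univ k)
    linarith
  calc traceNorm A ≤ ∑ _k : Fin 2 × Fin 1, (1 / 2 : ℝ) := Finset.sum_le_sum fun k _ => hk k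
    _ = 1 := by simp

/-- A one-dimensional ancilla suffices. The factor 2 undoes the halving of the matrix unit, which
allows a crude count of eigenvalues in place of its exact trace norm. -/
lemma norm_entry_le_of_diamondNorm_le {Φ : SuperOp} {b : ℝ} (hb : 0 ≤ b)
    (h : diamondNorm Φ ≤ ENNReal.ofReal b) (u w i j : Fin 2) :
    ‖Φ (Matrix.single u w 1) i j‖ ≤ 2 * b := by
  have h1 := (le_iSup₂_of_le (f := fun (n : ℕ) (X : Matrix (Fin 2 × Fin n) (Fin 2 × Fin n) ℂ) =>
    ⨆ (_ : traceNorm X ≤ 1), ENNReal.ofReal (traceNorm (withAncilla Φ n X))) 1 _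
    (le_iSup (fun _ => _) (traceNorm_half_unit_le u w))).trans h
  rw [ENNReal.ofReal_le_ofReal_iff hb] at h1
  have h2 := (norm_entry_le_traceNorm _ (i, 0) (j, 0)).trans h1
  have h3 : (Matrix.of fun i j => (Matrix.single u w (1 / 2 : ℂ)) i j)
      = (1 / 2 : ℂ) • (Matrix.single u w (1 : ℂ)) := by
    rw [Matrix.smul_single]; ext i j; simp
  simp only [withAncilla, Matrix.of_apply] at h2
  rw [h3, map_smul] at h2
  simp only [Matrix.smul_apply, smul_eq_mul, norm_mul] at h2
  norm_num at h2
  linarith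

/-! ### Algebra of product operators -/

section TensorProducts

variable {N : ℕ}

lemma tensorOp_mul (A B : Fin N → QubitOp) :
    tensorOp A * tensorOp B = tensorOp fun j => A j * B j := by
  ext x y
  simp only [tensorOp, Matrix.mul_apply, Matrix.of_apply, Finset.prod_univ_sum,
    ← Finset.prod_mul_distrib, Fintype.piFinset_univ]

lemma conjTranspose_tensorOp (A : Fin N → QubitOp) :
    (tensorOp A).conjTranspose = tensorOp fun j => (A j).conjTranspose := by
  ext x y
  simp [tensorOp, Matrix.conjTranspose_apply]

lemma trace_tensorOp (A : Fin N → QubitOp) : (tensorOp A).trace = ∏ j, (A j).trace := by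
  simp only [Matrix.trace, Matrix.diag, tensorOp, Matrix.of_apply, Finset.prod_univ_sum,
    Fintype.piFinset_univ]

lemma commute_onSite {m n : ℕ} (h : m ≠ n) (A B : QubitOp) :
    Commute (onSite N m A) (onSite N n B) := by
  simp only [Commute, SemiconjBy, onSite, tensorOp_mul]
  congr 1
  funext j
  split_ifs with h1 h2
  · exact absurd (h1.symm.trans h2) h
  all_goals simp

lemma conjTranspose_onSite {n : ℕ} {A : QubitOp} (hA : A.conjTranspose = A) :
    (onSite N n A).conjTranspose = onSite N n A := by
  rw [onSite, conjTranspose_tensorOp]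
  congr 1
  funext j
  split_ifs <;> simp [hA]

end TensorProducts

/-! ### The domino dynamics in the one-wall sector -/

section Hamiltonian

variable {N : ℕ}

lemma conjTranspose_pauliX : pauliX.conjTranspose = pauliX := by
  ext i j; fin_cases i <;> fin_cases j <;> simp [pauliX]

lemma conjTranspose_pauliZ : pauliZ.conjTranspose = pauliZ := by
  ext i j; fin_cases i <;> fin_cases j <;> simp [pauliZ]

lemma dominoH_isHermitian (N : ℕ) : (dominoH N).conjTranspose = dominoH N := by
  rw [dominoH, Matrix.conjTranspose_smul, Matrix.conjTranspose_sum]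
  congr 1
  · simp
  · refine Finset.sum_congr rfl fun i hi => ?_
    have hi := Finset.mem_Icc.1 hi
    rw [Matrix.conjTranspose_mul, Matrix.conjTranspose_sub, Matrix.conjTranspose_mul,
      conjTranspose_onSite conjTranspose_pauliX, conjTranspose_onSite conjTranspose_pauliZ,
      conjTranspose_onSite conjTranspose_pauliZ, Matrix.conjTranspose_one,
      (commute_onSite (by omega : i + 1 ≠ i - 1) pauliZ pauliZ).eq]
    exact ((Commute.one_left _).sub_left ((commute_onSite (by omega) _ _).mul_left
      (commute_onSite (by omega) _ _))).eq

lemma dominoU_unitary (N : ℕ) (T : ℝ) : (dominoU N T).conjTranspose * dominoU N T = 1 := by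
  have h : ((-Complex.I * (T : ℂ)) • dominoH N).conjTranspose
      = -((-Complex.I * (T : ℂ)) • dominoH N) := by
    rw [Matrix.conjTranspose_smul, dominoH_isHermitian, ← neg_smul]
    simp
  rw [dominoU, ← Matrix.exp_conjTranspose, h, Matrix.exp_neg]
  exact Matrix.nonsing_inv_mul _ ((Matrix.isUnit_iff_isUnit_det _).1 (Matrix.isUnit_exp _))

lemma onSite_pauliZ_apply (n : ℕ) (x y : Config N) :
    onSite N n pauliZ x y =
      if x = y then ∏ j : Fin N, if (j : ℕ) + 1 = n then (if y j = 0 then 1 else -1 : ℂ) else 1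
      else 0 := by
  simp only [onSite, tensorOp, Matrix.of_apply]
  split_ifs with h
  · subst h
    refine Finset.prod_congr rfl fun j _ => ?_
    split_ifs with h1 h2
    · simp [h2, pauliZ]
    · have : x j = 1 := by omega
      simp [this, pauliZ]
    · simp
  · obtain ⟨j, hj⟩ := Function.ne_iff.1 h
    refine Finset.prod_eq_zero (Finset.mem_univ j) ?_
    split_ifs
    · simp only [pauliZ]
      generalize x j = a at *
      generalize y j = b at *
      fin_cases a <;> fin_cases b <;> simp_all
    · simp [hj]

lemma onSite_pauliZ_wallConfig {n k : ℕ} (hn : 1 ≤ n) (hnN : n ≤ N) (x : Config N) :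
    onSite N n pauliZ x (wallConfig N k) =
      if x = wallConfig N k then (if n ≤ k then -1 else 1) else 0 := by
  rw [onSite_pauliZ_apply]
  congr 1
  rw [Finset.prod_eq_single (⟨n - 1, by omega⟩ : Fin N)]
  · have : n - 1 + 1 = n := by omega
    simp only [this, wallConfig]
    split_ifs <;> simp_all
  · intro j _ hj
    rw [if_neg]
    intro h
    exact hj (Fin.ext (by simp; omega))
  · simp

/-- Flipping site `i` exchanges the walls `i - 1` and `i`. Because `2 ≤ i`, the wall `0` is never
reached. -/
lemma wallConfig_eq_of_onSite_pauliX_ne_zero {i k : ℕ} (hi : 2 ≤ i) (hiN : i ≤ N - 1)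
    (hk : k = i ∨ k + 1 = i) {x : Config N} (hx : onSite N i pauliX x (wallConfig N k) ≠ 0) :
    ∃ m ∈ Finset.Icc 1 N, x = wallConfig N m := by
  simp only [onSite, tensorOp, Matrix.of_apply] at hx
  have hj := fun j => Finset.prod_ne_zero_iff.1 hx j (Finset.mem_univ j)
  have hoff : ∀ j : Fin N, (j : ℕ) + 1 ≠ i → x j = wallConfig N k j := by
    intro j hji
    have := hj j
    rw [if_neg hji] at this
    by_contra hne
    exact this (Matrix.one_apply_ne hne)
  have hon : ∀ j : Fin N, (j : ℕ) + 1 = i → x j ≠ wallConfig N k j := by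
    intro j hji he
    have := hj j
    rw [if_pos hji, he] at this
    generalize wallConfig N k j = a at this
    fin_cases a <;> simp [pauliX] at this
  rcases hk with hk | hk
  · refine ⟨i - 1, by simp; omega, ?_⟩
    funext j
    by_cases hji : (j : ℕ) + 1 = i
    · have := hon j hji
      simp only [wallConfig] at this ⊢
      split_ifs at * <;> omega
    · rw [hoff j hji]
      simp only [wallConfig]
      split_ifs <;> omega
  · refine ⟨i, by simp; omega, ?_⟩
    funext j
    by_cases hji : (j : ℕ) + 1 = i
    · have := hon j hji
      simp only [wallConfig] at this ⊢
      split_ifs at * <;> omega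
    · rw [hoff j hji]
      simp only [wallConfig]
      split_ifs <;> omega

/-- The factor `1 - Z Z` is 2 when the neighbours of `i` carry different bits and 0 otherwise; on
the wall `k` they differ exactly when `i - 1 ≤ k < i + 1`. -/
lemma domino_term_wallConfig {i k : ℕ} (hi : 2 ≤ i) (hiN : i ≤ N - 1) (x : Config N) :
    (onSite N i pauliX * (1 - onSite N (i - 1) pauliZ * onSite N (i + 1) pauliZ)) x
      (wallConfig N k) =
    if k = i ∨ k + 1 = i then 2 * onSite N i pauliX x (wallConfig N k) else 0 := by
  have hD : ∀ z, (1 - onSite N (i - 1) pauliZ * onSite N (i + 1) pauliZ) z (wallConfig N k) =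
      if z = wallConfig N k then (if k = i ∨ k + 1 = i then 2 else 0) else 0 := by
    intro z
    rw [Matrix.sub_apply, Matrix.mul_apply, Finset.sum_eq_single (wallConfig N k)]
    · rw [onSite_pauliZ_wallConfig (by omega) (by omega),
        onSite_pauliZ_wallConfig (by omega) (by omega), Matrix.one_apply]
      split_ifs <;> first | omega | norm_num
      all_goals simp_all
    · intro b _ hb
      rw [onSite_pauliZ_wallConfig (by omega) (by omega) b, if_neg hb, mul_zero]
    · simp
  rw [Matrix.mul_apply, Finset.sum_eq_single (wallConfig N k)]
  · rw [hD, if_pos rfl]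
    split_ifs <;> ring
  · intro b _ hb
    rw [hD, if_neg hb, mul_zero]
  · simp

lemma dominoH_wallConfig_zero (x : Config N) : dominoH N x (wallConfig N 0) = 0 := by
  rw [dominoH, Matrix.smul_apply, Matrix.sum_apply, Finset.sum_eq_zero, smul_zero]
  intro i hi
  have hi := Finset.mem_Icc.1 hi
  rw [domino_term_wallConfig hi.1 hi.2, if_neg (by omega)]

/-- The Hamiltonian preserves the span of the one-wall configurations. -/
lemma dominoH_wallConfig_eq_zero {k : ℕ} {x : Config N}
    (hx : ∀ m ∈ Finset.Icc 1 N, x ≠ wallConfig N m) : dominoH N x (wallConfig N k) = 0 := by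
  rw [dominoH, Matrix.smul_apply, Matrix.sum_apply, Finset.sum_eq_zero, smul_zero]
  intro i hi
  have hi := Finset.mem_Icc.1 hi
  rw [domino_term_wallConfig hi.1 hi.2]
  split_ifs with h
  · by_contra hne
    obtain ⟨m, hm, hxm⟩ := wallConfig_eq_of_onSite_pauliX_ne_zero hi.1 hi.2 h
      (right_ne_zero_of_mul hne)
    exact hx m hm hxm
  · rfl

open Classical in
lemma dominoU_wallConfig_one_eq_zero (hN : 1 ≤ N) (T : ℝ) {x : Config N}
    (hx : ∀ m ∈ Finset.Icc 1 N, x ≠ wallConfig N m) : dominoU N T x (wallConfig N 1) = 0 := by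
  -- Invariance of the span of the walls is block triangularity for a two-block labelling, a
  -- property that the matrix exponential inherits.
  have h : ((-Complex.I * (T : ℂ)) • dominoH N).BlockTriangular
      (fun y => if ∃ m ∈ Finset.Icc 1 N, y = wallConfig N m then (0 : ℕ) else 1) := by
    intro a b hab
    simp only at hab
    split_ifs at hab with h1 h2 h2
    · omega
    · obtain ⟨m, hm, rfl⟩ := h1
      rw [Matrix.smul_apply, dominoH_wallConfig_eq_zero, smul_zero]
      exact fun m hm he => h2 ⟨m, hm, he⟩
    · omega
    · omega
  refine h.exp ?_
  rw [if_pos ⟨1, by simp [hN], rfl⟩, if_neg]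
  · norm_num
  · rintro ⟨m, hm, he⟩
    exact hx m hm he

/-- Only the zeroth term of the exponential series survives multiplication by `P`. -/
lemma _root_.Matrix.exp_mul_of_mul_eq_zero {ι : Type*} [Fintype ι] [DecidableEq ι]
    {A P : Matrix ι ι ℂ} (h : A * P = 0) : NormedSpace.exp A * P = P := by
  let : NormedRing (Matrix ι ι ℂ) := Matrix.linftyOpNormedRing
  let : NormedAlgebra ℂ (Matrix ι ι ℂ) := Matrix.linftyOpNormedAlgebra
  have h1 := (NormedSpace.exp_series_hasSum_exp' (𝕂 := ℂ) A).mul_right P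
  refine h1.unique ?_
  have h2 := hasSum_single (f := fun n : ℕ => ((Nat.factorial n : ℂ)⁻¹ • A ^ n) * P) 0 ?_
  · rw [pow_zero, Nat.factorial_zero, Nat.cast_one, inv_one, one_smul, one_mul] at h2
    exact h2
  · intro n hn
    obtain ⟨m, rfl⟩ := Nat.exists_eq_succ_of_ne_zero hn
    simp [pow_succ, Matrix.mul_assoc, h]

lemma dominoU_wallConfig_zero (T : ℝ) (x : Config N) :
    dominoU N T x (wallConfig N 0) = if x = wallConfig N 0 then 1 else 0 := by
  have h : ((-Complex.I * (T : ℂ)) • dominoH N) *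
      Matrix.single (wallConfig N 0) (wallConfig N 0) (1 : ℂ) = 0 := by
    ext a b
    by_cases hb : b = wallConfig N 0
    · subst hb
      simp [dominoH_wallConfig_zero]
    · simp [Matrix.mul_single_apply_of_ne _ _ _ _ _ hb]
  have h2 := congrFun (congrFun (Matrix.exp_mul_of_mul_eq_zero h) x) (wallConfig N 0)
  rw [Matrix.mul_single_apply_same, mul_one] at h2
  rw [dominoU, h2, Matrix.single_apply]
  simp [eq_comm]

lemma wallConfig_injOn (N : ℕ) : Set.InjOn (wallConfig N) (Finset.range (N + 1)) := by
  have key : ∀ k l, k < l → l < N + 1 → wallConfig N k ≠ wallConfig N l := by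
    intro k l hkl hl he
    have := congrFun he (⟨k, by omega⟩ : Fin N)
    simp only [wallConfig] at this
    rw [if_neg (by omega), if_pos (by omega)] at this
    exact absurd this (by decide)
  intro k hk l hl he
  simp only [Finset.coe_range, Set.mem_Iio] at hk hl
  rcases lt_trichotomy k l with h | h | h
  · exact absurd he (key k l h hl)
  · exact h
  · exact absurd he.symm (key l k h hk)

/-- A column of a unitary has norm 1, and this column is supported on the walls. -/
lemma sum_norm_sq_amp (hN : 1 ≤ N) (T : ℝ) : ∑ i ∈ Finset.Icc 1 N, ‖amp N T i‖ ^ 2 = 1 := by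
  have h := congrFun (congrFun (dominoU_unitary N T) (wallConfig N 1)) (wallConfig N 1)
  rw [Matrix.mul_apply, Matrix.one_apply_eq] at h
  have h1 : ∑ x, ‖dominoU N T x (wallConfig N 1)‖ ^ 2 = 1 := by
    have : ((∑ x, ‖dominoU N T x (wallConfig N 1)‖ ^ 2 : ℝ) : ℂ) = 1 := by
      rw [← h]
      push_cast
      refine Finset.sum_congr rfl fun x _ => ?_
      rw [Matrix.conjTranspose_apply]
      exact (Complex.conj_mul' _).symm
    exact_mod_cast this
  classical
  rw [← h1]
  have hinj : Set.InjOn (wallConfig N) (Finset.Icc 1 N) := (wallConfig_injOn N).mono (by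
    intro k hk
    simp at hk ⊢
    omega)
  simp only [amp]
  rw [← Finset.sum_image (f := fun x => ‖dominoU N T x (wallConfig N 1)‖ ^ 2) hinj]
  refine Finset.sum_subset (Finset.subset_univ _) fun x _ hx => ?_
  rw [dominoU_wallConfig_one_eq_zero hN T, norm_zero, zero_pow two_ne_zero]
  intro m hm he
  exact hx (Finset.mem_image.2 ⟨m, hm, he.symm⟩)

end Hamiltonian

/-! ### Schur test for the noise-induced matrix elements -/

/-- The kernel `δ^{l-k}` of a Schur test, above the diagonal. -/
lemma sum_strict_kernel_le {n : ℕ} {δ : ℝ} (h0 : 0 ≤ δ) (h1 : δ ≤ 1 / 2) (x y : ℕ → ℝ) :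
    ∑ k ∈ Finset.range n, ∑ l ∈ Finset.range n, (if k < l then x k * y l * δ ^ (l - k) else 0)
      ≤ δ * (∑ k ∈ Finset.range n, x k ^ 2 + ∑ k ∈ Finset.range n, y k ^ 2) := by
  have hgeo : ∀ m, ∑ i ∈ Finset.range m, δ ^ (i + 1) ≤ 2 * δ := by
    intro m
    have h2 : ∑ i ∈ Finset.range m, δ ^ i ≤ 2 := by
      have h3 : (∑ i ∈ Finset.range m, δ ^ i) * (1 - δ) = 1 - δ ^ m := geom_sum_mul_neg δ m
      have h4 : 0 ≤ δ ^ m := by positivity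
      have h5 : 0 ≤ ∑ i ∈ Finset.range m, δ ^ i := by positivity
      nlinarith
    simp_rw [pow_succ]
    rw [← Finset.sum_mul]
    nlinarith
  -- Rows and columns of the kernel are both reindexed injectively by the gap `l - k - 1`, which
  -- reduces each to the geometric series.
  have himg : ∀ (A : Finset ℕ) (g : ℕ → ℕ), Set.InjOn g A → (∀ a ∈ A, g a < n) →
      ∑ a ∈ A, δ ^ (g a + 1) ≤ 2 * δ := by
    intro A g hg hlt
    rw [← Finset.sum_image (f := fun i => δ ^ (i + 1)) hg]
    refine (Finset.sum_le_sum_of_subset_of_nonneg (t := Finset.range n) ?_ ?_).trans (hgeo n)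
    · intro i hi
      obtain ⟨a, ha, rfl⟩ := Finset.mem_image.1 hi
      exact Finset.mem_range.2 (hlt a ha)
    · intro i _ _
      positivity
  have hrow : ∀ k, ∑ l ∈ Finset.range n, (if k < l then δ ^ (l - k) else 0) ≤ 2 * δ := by
    intro k
    rw [← Finset.sum_filter]
    refine le_trans (le_of_eq ?_) (himg {l ∈ Finset.range n | k < l} (fun l => l - k - 1) ?_ ?_)
    · refine Finset.sum_congr rfl fun l hl => ?_
      have := (Finset.mem_filter.1 hl).2
      congr 1; omega
    · intro a ha b hb hab
      simp at ha hb hab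
      omega
    · intro a ha
      simp at ha
      omega
  have hcol : ∀ l ∈ Finset.range n,
      ∑ k ∈ Finset.range n, (if k < l then δ ^ (l - k) else 0) ≤ 2 * δ := by
    intro l hln
    rw [← Finset.sum_filter]
    refine le_trans (le_of_eq ?_) (himg {k ∈ Finset.range n | k < l} (fun k => l - k - 1) ?_ ?_)
    · refine Finset.sum_congr rfl fun k hk => ?_
      have := (Finset.mem_filter.1 hk).2
      congr 1; omega
    · intro a ha b hb hab
      simp at ha hb hab
      omega
    · intro a ha
      simp at ha hln
      omega
  have hpt : ∀ k l, (if k < l then x k * y l * δ ^ (l - k) else 0) ≤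
      x k ^ 2 / 2 * (if k < l then δ ^ (l - k) else 0) +
      y l ^ 2 / 2 * (if k < l then δ ^ (l - k) else 0) := by
    intro k l
    split_ifs
    · have : 0 ≤ δ ^ (l - k) := by positivity
      nlinarith [mul_nonneg this (sq_nonneg (x k - y l))]
    · simp
  calc _ ≤ ∑ k ∈ Finset.range n, ∑ l ∈ Finset.range n,
        (x k ^ 2 / 2 * (if k < l then δ ^ (l - k) else 0) +
          y l ^ 2 / 2 * (if k < l then δ ^ (l - k) else 0)) :=
        Finset.sum_le_sum fun k _ => Finset.sum_le_sum fun l _ => hpt k l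
    _ = ∑ k ∈ Finset.range n, x k ^ 2 / 2 *
          ∑ l ∈ Finset.range n, (if k < l then δ ^ (l - k) else 0) +
        ∑ l ∈ Finset.range n, y l ^ 2 / 2 *
          ∑ k ∈ Finset.range n, (if k < l then δ ^ (l - k) else 0) := by
        simp_rw [Finset.sum_add_distrib, Finset.mul_sum]
        congr 1
        exact Finset.sum_comm
    _ ≤ ∑ k ∈ Finset.range n, x k ^ 2 / 2 * (2 * δ) +
        ∑ l ∈ Finset.range n, y l ^ 2 / 2 * (2 * δ) := by
        gcongr with k _ l hl
        · exact hrow k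
        · exact hcol l hl
    _ = _ := by
        rw [← Finset.sum_mul, ← Finset.sum_mul, ← Finset.sum_div, ← Finset.sum_div]
        ring

/-- Upper bound for the modulus of the matrix element between the walls `k` and `l` of a string on
the sites `s + 1, …, e` whose diagonal entries are at most `δ`. -/
noncomputable def stringWeight (δ : ℝ) (s e k l : ℕ) : ℝ :=
  if k = l then δ ^ (e - s)
  else if s ≤ min k l ∧ max k l ≤ e then δ ^ ((min k l - s) + (e - max k l)) else 0

lemma stringWeight_nonneg {δ : ℝ} (h0 : 0 ≤ δ) (s e k l : ℕ) : 0 ≤ stringWeight δ s e k l := by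
  unfold stringWeight
  split_ifs <;> positivity

/-- The weighted contribution of all walls other than the two that delimit the string. -/
lemma sum_stringWeight_le {n : ℕ} {δ : ℝ} (h0 : 0 ≤ δ) (h1 : δ ≤ 1 / 2) {x y r : ℕ → ℝ}
    (hx : ∀ i, 0 ≤ x i) (hy : ∀ i, 0 ≤ y i) (hr : ∀ i, 0 ≤ r i)
    (hx1 : ∑ i ∈ Finset.range n, x i ^ 2 ≤ 1) (hy1 : ∑ i ∈ Finset.range n, y i ^ 2 ≤ 1)
    (hr2 : ∑ i ∈ Finset.range n, r i ^ 2 ≤ 2) :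
    ∑ s ∈ Finset.range n, ∑ e ∈ Finset.range n, (if s < e then x s * y e *
      ∑ k ∈ Finset.range n, ∑ l ∈ Finset.range n,
        (if (k = s ∧ l = e) ∨ (k = e ∧ l = s) then 0 else r k * r l * stringWeight δ s e k l)
      else 0) ≤ 40 * δ := by
  set R := Finset.range n with hR
  -- `E` is the kernel strictly above the diagonal, of total size `O(δ)`; `G` is the diagonal
  -- kernel, of size `O(1)`.
  let E : (ℕ → ℝ) → (ℕ → ℝ) → ℕ → ℕ → ℝ := fun x y k l =>
    if k < l then x k * y l * δ ^ (l - k) else 0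
  let G : (ℕ → ℝ) → (ℕ → ℝ) → ℕ → ℕ → ℝ := fun x y k l =>
    if k = l then x k * y l else 0
  have hE : ∀ x y : ℕ → ℝ, (∀ i, 0 ≤ x i) → (∀ i, 0 ≤ y i) → ∀ k l, 0 ≤ E x y k l := by
    intro x y hx hy k l
    have := hx k; have := hy l
    simp only [E]; split_ifs <;> positivity
  have hG : ∀ x y : ℕ → ℝ, (∀ i, 0 ≤ x i) → (∀ i, 0 ≤ y i) → ∀ k l, 0 ≤ G x y k l := by
    intro x y hx hy k l
    have := hx k; have := hy l
    simp only [G]; split_ifs <;> positivity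
  have hExr : ∑ s ∈ R, ∑ k ∈ R, E x r s k ≤ 3 * δ := by
    have := sum_strict_kernel_le (n := n) h0 h1 x r
    simp only [E]
    nlinarith
  have hEry : ∑ l ∈ R, ∑ e ∈ R, E r y l e ≤ 3 * δ := by
    have := sum_strict_kernel_le (n := n) h0 h1 r y
    simp only [E]
    nlinarith
  have hExy : ∑ s ∈ R, ∑ e ∈ R, E x y s e ≤ 2 * δ := by
    have := sum_strict_kernel_le (n := n) h0 h1 x y
    simp only [E]
    nlinarith
  have hGle : ∀ x y : ℕ → ℝ, ∑ s ∈ R, x s ^ 2 + ∑ s ∈ R, y s ^ 2 ≤ 3 →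
      ∑ s ∈ R, ∑ k ∈ R, G x y s k ≤ 3 / 2 := by
    intro x y h
    have h2 : ∀ s ∈ R, ∑ k ∈ R, G x y s k ≤ x s ^ 2 / 2 + y s ^ 2 / 2 := by
      intro s hs
      simp only [G]
      rw [Finset.sum_ite_eq, if_pos hs]
      nlinarith [sq_nonneg (x s - y s)]
    refine (Finset.sum_le_sum h2).trans ?_
    rw [Finset.sum_add_distrib, ← Finset.sum_div, ← Finset.sum_div]
    linarith
  have hGxr := hGle x r (by linarith)
  have hGry := hGle r y (by linarith)
  -- the three kinds of contributions
  let U : ℕ → ℕ → ℕ → ℕ → ℝ := fun s e k l =>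
    E x r s k * (E r y l e + G r y l e) + G x r s k * E r y l e
  have hU0 : ∀ s e k l, 0 ≤ U s e k l := fun s e k l =>
    add_nonneg (mul_nonneg (hE _ _ hx hr _ _) (add_nonneg (hE _ _ hr hy _ _) (hG _ _ hr hy _ _)))
      (mul_nonneg (hG _ _ hx hr _ _) (hE _ _ hr hy _ _))
  -- For `k = l` all sites of the string have matching bits, which gives `δ^(e-s)` whatever the
  -- position of the wall.
  let Dg : ℕ → ℕ → ℕ → ℕ → ℝ := fun s e k l => E x y s e * (if k = l then r k ^ 2 else 0)
  have hDg0 : ∀ s e k l, 0 ≤ Dg s e k l := fun s e k l =>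
    mul_nonneg (hE _ _ hx hy _ _) (by split_ifs <;> positivity)
  have hoff : ∀ s e k l, s < e → k < l → ¬ (k = s ∧ l = e) → s ≤ k → l ≤ e →
      x s * y e * (r k * r l * δ ^ ((k - s) + (e - l))) ≤ U s e k l := by
    intro s e k l hse hkl hne hsk hle
    rcases hsk.lt_or_eq with h | h <;> rcases hle.lt_or_eq with h' | h'
    · refine le_of_eq ?_
      simp only [U, E, G, if_pos h, if_pos h', if_neg h.ne, if_neg h'.ne, pow_add]
      ring
    · subst h'
      refine le_of_eq ?_
      simp only [U, E, G, if_pos h, if_neg h.ne, lt_irrefl, if_true, if_false, pow_add, Nat.sub_self]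
      ring
    · subst h
      refine le_of_eq ?_
      simp only [U, E, G, if_pos h', if_neg h'.ne, lt_irrefl, if_true, if_false, pow_add,
        Nat.sub_self]
      ring
    · exact absurd ⟨h.symm, h'⟩ hne
  have hpt : ∀ s e, (if s < e then x s * y e *
      ∑ k ∈ R, ∑ l ∈ R,
        (if (k = s ∧ l = e) ∨ (k = e ∧ l = s) then 0 else r k * r l * stringWeight δ s e k l)
      else 0) ≤ ∑ k ∈ R, ∑ l ∈ R, (Dg s e k l + U s e k l + U s e l k) := by
    intro s e
    split_ifs with hse
    · rw [Finset.mul_sum]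
      refine Finset.sum_le_sum fun k _ => ?_
      rw [Finset.mul_sum]
      refine Finset.sum_le_sum fun l _ => ?_
      have hd := hDg0 s e k l
      have hu := hU0 s e k l
      have hu' := hU0 s e l k
      split_ifs with hc
      · rw [mul_zero]; positivity
      · unfold stringWeight
        rcases lt_trichotomy k l with h | h | h
        · rw [if_neg h.ne, min_eq_left h.le, max_eq_right h.le]
          split_ifs with hin
          · have := hoff s e k l hse h (fun h => hc (Or.inl h)) hin.1 hin.2
            linarith
          · simp only [mul_zero]; positivity
        · subst h
          have : x s * y e * (r k * r k * δ ^ (e - s)) = Dg s e k k := by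
            simp only [Dg, E, if_pos hse, if_true]; ring
          rw [if_pos rfl]
          linarith
        · rw [if_neg h.ne', min_eq_right h.le, max_eq_left h.le]
          split_ifs with hin
          · have := hoff s e l k hse h (fun h => hc (Or.inr h.symm)) hin.1 hin.2
            rw [mul_comm (r k)]
            linarith
          · simp only [mul_zero]; positivity
    · exact Finset.sum_nonneg fun k _ => Finset.sum_nonneg fun l _ =>
        add_nonneg (add_nonneg (hDg0 _ _ _ _) (hU0 _ _ _ _)) (hU0 _ _ _ _)
  have hprod : ∀ f g : ℕ → ℕ → ℝ, ∑ s ∈ R, ∑ e ∈ R, ∑ k ∈ R, ∑ l ∈ R, f s k * g l e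
      = (∑ s ∈ R, ∑ k ∈ R, f s k) * (∑ l ∈ R, ∑ e ∈ R, g l e) := by
    intro f g
    simp_rw [← Finset.mul_sum, ← Finset.sum_mul]
    rw [Finset.sum_comm (f := fun l e => g l e), ← Finset.sum_mul_sum]
  have hUsum : ∑ s ∈ R, ∑ e ∈ R, ∑ k ∈ R, ∑ l ∈ R, U s e k l ≤ 18 * δ := by
    simp only [U, mul_add, Finset.sum_add_distrib, hprod]
    have e1 : 0 ≤ ∑ s ∈ R, ∑ k ∈ R, E x r s k :=
      Finset.sum_nonneg fun _ _ => Finset.sum_nonneg fun _ _ => hE _ _ hx hr _ _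
    have e2 : 0 ≤ ∑ s ∈ R, ∑ k ∈ R, E r y s k :=
      Finset.sum_nonneg fun _ _ => Finset.sum_nonneg fun _ _ => hE _ _ hr hy _ _
    have e3 : 0 ≤ ∑ s ∈ R, ∑ k ∈ R, G r y s k :=
      Finset.sum_nonneg fun _ _ => Finset.sum_nonneg fun _ _ => hG _ _ hr hy _ _
    have m1 := mul_le_mul hExr hEry e2 (by positivity)
    have m2 := mul_le_mul hExr hGry e3 (by positivity)
    have m3 := mul_le_mul hGxr hEry e2 (by positivity)
    nlinarith
  have hDsum : ∑ s ∈ R, ∑ e ∈ R, ∑ k ∈ R, ∑ l ∈ R, Dg s e k l ≤ 4 * δ := by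
    have : ∀ s e, ∑ k ∈ R, ∑ l ∈ R, Dg s e k l = E x y s e * ∑ k ∈ R, r k ^ 2 := by
      intro s e
      simp only [Dg, ← Finset.mul_sum]
      congr 1
      refine Finset.sum_congr rfl fun k hk => ?_
      rw [Finset.sum_ite_eq, if_pos hk]
    simp only [this, ← Finset.sum_mul]
    have e1 : 0 ≤ ∑ s ∈ R, r s ^ 2 := by positivity
    have := mul_le_mul hExy hr2 e1 (by positivity)
    linarith
  have hswap : ∑ s ∈ R, ∑ e ∈ R, ∑ k ∈ R, ∑ l ∈ R, U s e l k
      = ∑ s ∈ R, ∑ e ∈ R, ∑ k ∈ R, ∑ l ∈ R, U s e k l :=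
    Finset.sum_congr rfl fun s _ => Finset.sum_congr rfl fun e _ => Finset.sum_comm
  -- The total is `18 + 18 + 4 = 40` times `δ`: the two orders of `k, l` and the diagonal.
  refine (Finset.sum_le_sum fun s _ => Finset.sum_le_sum fun e _ => hpt s e).trans ?_
  simp only [Finset.sum_add_distrib, hswap]
  linarith

/-! ### The domino state and its expectation values in wall coordinates -/

/-- The amplitudes of `√2 |ψ⟩` on the walls `0, 1, …, N`. -/
noncomputable def wallAmp (N : ℕ) (T : ℝ) (k : ℕ) : ℂ := if k = 0 then 1 else amp N T k

lemma initialState_eq {N : ℕ} (hN : 1 ≤ N) (x : Config N) :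
    initialState N x = ((Real.sqrt 2)⁻¹ : ℂ) *
      ((if x = wallConfig N 0 then 1 else 0) + (if x = wallConfig N 1 then 1 else 0)) := by
  obtain ⟨M, rfl⟩ : ∃ M, N = M + 1 := ⟨N - 1, by omega⟩
  rw [initialState, Fin.prod_univ_succ]
  simp only [Fin.val_zero, if_true, Fin.val_succ, Nat.succ_ne_zero, if_false]
  congr 1
  rw [Finset.prod_ite_zero]
  have h0 : x = wallConfig (M + 1) 0 ↔ x 0 = 0 ∧ ∀ i ∈ Finset.univ, x (Fin.succ i) = 0 := by
    constructor
    · rintro rfl; simp [wallConfig]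
    · rintro ⟨h1, h2⟩
      funext j
      refine Fin.cases ?_ (fun i => ?_) j
      · simp [h1, wallConfig]
      · simp [h2 i (Finset.mem_univ i), wallConfig]
  have h1 : x = wallConfig (M + 1) 1 ↔ x 0 = 1 ∧ ∀ i ∈ Finset.univ, x (Fin.succ i) = 0 := by
    constructor
    · rintro rfl; simp [wallConfig]
    · rintro ⟨h1, h2⟩
      funext j
      refine Fin.cases ?_ (fun i => ?_) j
      · simp [h1, wallConfig]
      · simp [h2 i (Finset.mem_univ i), wallConfig]
  rw [if_congr h0 rfl rfl, if_congr h1 rfl rfl]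
  generalize x 0 = a
  by_cases h : ∀ i ∈ Finset.univ, x (Fin.succ i) = 0
  · fin_cases a <;> simp_all
  · rw [if_neg h, if_neg fun h' => h h'.2, if_neg fun h' => h h'.2]
    simp

lemma dominoState_eq {N : ℕ} (hN : 1 ≤ N) (T : ℝ) (x : Config N) :
    dominoState N T x = ∑ k ∈ Finset.range (N + 1),
      ((Real.sqrt 2)⁻¹ : ℂ) * wallAmp N T k * (if x = wallConfig N k then 1 else 0) := by
  have h1 : dominoState N T x = ((Real.sqrt 2)⁻¹ : ℂ) *
      (dominoU N T x (wallConfig N 0) + dominoU N T x (wallConfig N 1)) := by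
    simp only [dominoState, Matrix.mulVec, dotProduct, initialState_eq hN, mul_add,
      Finset.sum_add_distrib, mul_ite, mul_one, mul_zero, Finset.sum_ite_eq', Finset.mem_univ,
      if_true]
    ring
  rw [h1, dominoU_wallConfig_zero, Finset.sum_range_succ', mul_add, add_comm]
  congr 1
  · simp only [wallAmp, Nat.succ_ne_zero, if_false]
    by_cases hx : ∃ m ∈ Finset.Icc 1 N, x = wallConfig N m
    · obtain ⟨m, hm, rfl⟩ := hx
      have hm := Finset.mem_Icc.1 hm
      rw [Finset.sum_eq_single (m - 1)]
      · have : m - 1 + 1 = m := by omega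
        rw [this, if_pos rfl, amp, mul_one]
      · intro b hb hbm
        have hb := Finset.mem_range.1 hb
        rw [if_neg, mul_zero]
        intro he
        have := wallConfig_injOn N (by simp; omega) (by simp; omega) he
        omega
      · intro h
        simp at h
        omega
    · push Not at hx
      rw [dominoU_wallConfig_one_eq_zero hN T hx, mul_zero, Finset.sum_eq_zero]
      intro k hk
      have hk := Finset.mem_range.1 hk
      rw [if_neg (hx (k + 1) (by simp; omega)), mul_zero]
  · simp [wallAmp]

lemma sum_norm_sq_wallAmp {N : ℕ} (hN : 1 ≤ N) (T : ℝ) :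
    ∑ k ∈ Finset.range (N + 1), ‖wallAmp N T k‖ ^ 2 = 2 := by
  have h := sum_norm_sq_amp hN T
  rw [Finset.sum_range_succ']
  have h2 : ∑ k ∈ Finset.range N, ‖wallAmp N T (k + 1)‖ ^ 2
      = ∑ i ∈ Finset.Icc 1 N, ‖amp N T i‖ ^ 2 := by
    rw [Finset.range_eq_Ico, Finset.sum_Ico_add' (fun k => ‖wallAmp N T k‖ ^ 2) 0 N 1]
    refine Finset.sum_congr ?_ fun i hi => ?_
    · ext i; simp [Nat.succ_le_iff]
    · have := Finset.mem_Ico.1 hi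
      rw [wallAmp, if_neg (by omega)]
  rw [h2, h]
  norm_num [wallAmp]

/-- The matrix elements of the dual channel: `tr (Φ(|u⟩⟨w|) B)`. -/
noncomputable def siteTerm (Φ : SuperOp) (B : QubitOp) (u w : Fin 2) : ℂ :=
  (Φ (Matrix.single u w 1) * B).trace

lemma trace_tensorPower_mul {N : ℕ} (Φ : SuperOp) (ρ : ChainOp N) (B : Fin N → QubitOp) :
    (tensorPower N Φ ρ * tensorOp B).trace =
      ∑ u, ∑ w, ρ u w * ∏ j, siteTerm Φ (B j) (u j) (w j) := by
  simp only [tensorPower, Finset.sum_mul, Matrix.trace_sum, Matrix.smul_mul, Matrix.trace_smul,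
    tensorOp_mul, trace_tensorOp, siteTerm, smul_eq_mul]

lemma expect_tensorPower_dominoRho {N : ℕ} (hN : 1 ≤ N) (T : ℝ) (Φ : SuperOp)
    (B : Fin N → QubitOp) :
    expect (tensorPower N Φ (dominoRho N T)) (tensorOp B) =
      (1 / 2) * (∑ k ∈ Finset.range (N + 1), ∑ l ∈ Finset.range (N + 1),
        wallAmp N T k * star (wallAmp N T l) *
          ∏ j, siteTerm Φ (B j) (wallConfig N k j) (wallConfig N l j)).re := by
  set c : ℂ := ((Real.sqrt 2)⁻¹ : ℂ) with hc
  have hcc : c * star c = ((1 / 2 : ℝ) : ℂ) := by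
    rw [hc]
    have : (Real.sqrt 2)⁻¹ * (Real.sqrt 2)⁻¹ = (1 / 2 : ℝ) := by
      rw [← mul_inv, Real.mul_self_sqrt (by norm_num)]; norm_num
    rw [← this]
    push_cast
    simp
  have h1 : ∀ G : Config N → Config N → ℂ, ∑ u, ∑ w, dominoRho N T u w * G u w =
      ((1 / 2 : ℝ) : ℂ) * ∑ k ∈ Finset.range (N + 1), ∑ l ∈ Finset.range (N + 1),
        wallAmp N T k * star (wallAmp N T l) * G (wallConfig N k) (wallConfig N l) := by
    intro G
    have e1 : ∀ g : Config N → ℂ, ∑ u, dominoState N T u * g u =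
        ∑ k ∈ Finset.range (N + 1), c * wallAmp N T k * g (wallConfig N k) := by
      intro g
      simp_rw [dominoState_eq hN, Finset.sum_mul]
      rw [Finset.sum_comm]
      simp [hc]
    have e2 : ∀ g : Config N → ℂ, ∑ u, star (dominoState N T u) * g u =
        ∑ k ∈ Finset.range (N + 1), star (c * wallAmp N T k) * g (wallConfig N k) := by
      intro g
      simp_rw [dominoState_eq hN, star_sum, Finset.sum_mul]
      rw [Finset.sum_comm]
      simp [hc, apply_ite]
    simp only [dominoRho, Matrix.vecMulVec_apply, Pi.star_apply, mul_assoc]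
    simp_rw [← Finset.mul_sum, e2]
    rw [e1, ← hcc]
    simp only [Finset.mul_sum]
    refine Finset.sum_congr rfl fun k _ => Finset.sum_congr rfl fun l _ => ?_
    rw [star_mul']
    ring
  rw [expect, trace_tensorPower_mul, h1, Complex.re_ofReal_mul]

/-! ### Matrix elements on one site -/

section SiteBounds

/-- Trace preservation makes the sites off the string noiseless: they contribute no error, and two
walls that differ there give exactly zero. -/
lemma siteTerm_one {Φ : SuperOp} (hΦ : IsChannel Φ) (u w : Fin 2) :
    siteTerm Φ 1 u w = if u = w then 1 else 0 := by
  rw [siteTerm, mul_one, hΦ.trace_preserving]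
  split_ifs with h
  · subst h; simp
  · simp [Matrix.trace_single_eq_of_ne _ _ _ h]

lemma rotY_eq (φ : ℝ) : rotY φ = !![0, -Complex.I * Complex.exp (-(Complex.I * φ));
    Complex.I * Complex.exp (Complex.I * φ), 0] := by
  ext i j
  fin_cases i <;> fin_cases j <;>
    simp [rotY, phaseGate, pauliY, ← Complex.exp_conj, mul_comm]

lemma rotY_mul_self (φ : ℝ) : rotY φ * rotY φ = 1 := by
  have h : Complex.exp (-(Complex.I * φ)) * Complex.exp (Complex.I * φ) = 1 := by
    rw [← Complex.exp_add]; simp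
  rw [rotY_eq]
  ext i j
  fin_cases i <;> fin_cases j <;> simp
  · linear_combination (-Complex.I * Complex.I) * h - Complex.I_mul_I
  · linear_combination (-Complex.I * Complex.I) * h - Complex.I_mul_I

lemma siteTerm_sub (Φ Ψ : SuperOp) (B : QubitOp) (u w : Fin 2) :
    siteTerm (Φ - Ψ) B u w = siteTerm Φ B u w - siteTerm Ψ B u w := by
  simp [siteTerm, Matrix.sub_mul]

lemma siteTerm_rotY (Φ : SuperOp) (φ : ℝ) (u w : Fin 2) :
    siteTerm Φ (rotY φ) u w =
      Φ (Matrix.single u w 1) 0 1 * (Complex.I * Complex.exp (Complex.I * φ)) +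
      Φ (Matrix.single u w 1) 1 0 * (-Complex.I * Complex.exp (-(Complex.I * φ))) := by
  rw [siteTerm, rotY_eq]
  simp [Matrix.trace_fin_two, Matrix.mul_apply, Fin.sum_univ_two]

/-- A rotated `Y` picks out the two off-diagonal entries of the output with unimodular coefficients,
and each entry is at most `2b`. -/
lemma norm_siteTerm_rotY_le {Φ : SuperOp} {b : ℝ} (hb : 0 ≤ b)
    (h : diamondNorm Φ ≤ ENNReal.ofReal b) (φ : ℝ) (u w : Fin 2) :
    ‖siteTerm Φ (rotY φ) u w‖ ≤ 4 * b := by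
  rw [siteTerm_rotY]
  refine (norm_add_le _ _).trans ?_
  have e1 : ‖Complex.I * Complex.exp (Complex.I * φ)‖ = 1 := by
    rw [norm_mul, Complex.norm_I, mul_comm Complex.I, Complex.norm_exp_ofReal_mul_I, one_mul]
  have e2 : ‖-Complex.I * Complex.exp (-(Complex.I * φ))‖ = 1 := by
    rw [norm_mul, norm_neg, Complex.norm_I,
      show -(Complex.I * (φ : ℂ)) = ((-φ : ℝ) : ℂ) * Complex.I by push_cast; ring,
      Complex.norm_exp_ofReal_mul_I, one_mul]
  rw [norm_mul, norm_mul (Φ (Matrix.single u w 1) 1 0), e1, e2]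
  have := norm_entry_le_of_diamondNorm_le hb h u w 0 1
  have := norm_entry_le_of_diamondNorm_le hb h u w 1 0
  linarith

/-- The `Y` matrix elements after the noiseless rotation. -/
lemma siteTerm_idealSensing (θ φ : ℝ) (u w : Fin 2) :
    siteTerm (idealSensing θ) (rotY φ) u w =
      if u = w then 0 else Complex.exp
        ((((u : ℕ) : ℂ) - ((w : ℕ) : ℂ)) * ((2 * θ - φ - Real.pi / 2 : ℝ) : ℂ) * Complex.I) := by
  have hp : Complex.exp (Real.pi / 2 * Complex.I) = Complex.I := Complex.exp_pi_div_two_mul_I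
  have hp' : Complex.exp (-(Real.pi / 2 * Complex.I)) = -Complex.I := by
    rw [Complex.exp_neg, hp, Complex.inv_I]
  rw [siteTerm_rotY]
  fin_cases u <;> fin_cases w <;>
    simp [idealSensing, phaseRot, Matrix.single, ← Complex.exp_conj, Matrix.diagonal_mul,
      Matrix.mul_diagonal, Matrix.diagonal_conjTranspose]
  · rw [show (Real.pi / 2 - (2 * (θ : ℂ) - φ)) * Complex.I =
      -(Complex.I * θ) + -(Complex.I * θ) + (Real.pi / 2 * Complex.I + Complex.I * φ) by ring,
      Complex.exp_add, Complex.exp_add, Complex.exp_add, hp]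
  · rw [show (2 * (θ : ℂ) - φ - Real.pi / 2) * Complex.I =
      (Complex.I * θ) + (Complex.I * θ) + (-(Real.pi / 2 * Complex.I) + -(Complex.I * φ)) by ring,
      Complex.exp_add, Complex.exp_add, Complex.exp_add, hp']
    ring

lemma hasDerivAt_siteTerm_idealSensing (θ φ : ℝ) (u w : Fin 2) :
    HasDerivAt (fun t => siteTerm (idealSensing t) (rotY φ) u w)
      ((((u : ℕ) : ℂ) - ((w : ℕ) : ℂ)) * 2 * Complex.I *
        siteTerm (idealSensing θ) (rotY φ) u w) θ := by
  simp only [siteTerm_idealSensing]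
  split_ifs
  · simpa using hasDerivAt_const θ (0 : ℂ)
  · have h1 : HasDerivAt (fun t : ℝ => (((2 * t - φ - Real.pi / 2 : ℝ)) : ℂ)) ((2 : ℝ) : ℂ) θ := by
      refine HasDerivAt.ofReal_comp ?_
      simpa using (((hasDerivAt_id θ).const_mul 2).sub_const φ).sub_const (Real.pi / 2)
    convert ((h1.const_mul (((u : ℕ) : ℂ) - ((w : ℕ) : ℂ))).mul_const Complex.I).cexp using 1
    push_cast
    ring

lemma norm_siteTerm_idealSensing (θ φ : ℝ) (u w : Fin 2) :
    ‖siteTerm (idealSensing θ) (rotY φ) u w‖ = if u = w then 0 else 1 := by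
  rw [siteTerm_idealSensing]
  split_ifs
  · simp
  · rw [show (((u : ℕ) : ℂ) - ((w : ℕ) : ℂ)) * ((2 * θ - φ - Real.pi / 2 : ℝ) : ℂ) * Complex.I
      = ((((u : ℕ) : ℝ) - ((w : ℕ) : ℝ)) * (2 * θ - φ - Real.pi / 2) : ℝ) * Complex.I by
        push_cast; ring]
    exact Complex.norm_exp_ofReal_mul_I _

lemma HasSuperDerivAt.siteTerm {Φ : ℝ → SuperOp} {D : SuperOp} {θ : ℝ}
    (h : HasSuperDerivAt Φ D θ) (φ : ℝ) (u w : Fin 2) :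
    HasDerivAt (fun t => siteTerm (Φ t) (rotY φ) u w) (siteTerm D (rotY φ) u w) θ := by
  simp only [siteTerm_rotY]
  exact ((h _ 0 1).mul_const _).add ((h _ 1 0).mul_const _)

end SiteBounds

/-! ### Perturbation of products and of their derivatives -/

section ProductBounds

variable {ι : Type*} [DecidableEq ι]

/-- Factors are replaced one at a time; unreplaced ones have norm at most `1 + d i`, replaced ones
at most 1. -/
lemma norm_prod_sub_prod_le (A : Finset ι) {f h : ι → ℂ} {d : ι → ℝ}
    (hh : ∀ i ∈ A, ‖h i‖ ≤ 1) (hd : ∀ i ∈ A, ‖f i - h i‖ ≤ d i) :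
    ‖∏ i ∈ A, f i - ∏ i ∈ A, h i‖ ≤ ∏ i ∈ A, (1 + d i) - 1 := by
  induction A using Finset.induction_on with
  | empty => simp
  | insert a A ha ih =>
    rw [Finset.prod_insert ha, Finset.prod_insert ha, Finset.prod_insert ha]
    have ih := ih (fun i hi => hh i (Finset.mem_insert_of_mem hi))
      (fun i hi => hd i (Finset.mem_insert_of_mem hi))
    have h1 := hh a (Finset.mem_insert_self a A)
    have h2 := hd a (Finset.mem_insert_self a A)
    have hf : ‖f a‖ ≤ 1 + d a := by
      calc ‖f a‖ = ‖h a + (f a - h a)‖ := by ring_nf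
        _ ≤ 1 + d a := (norm_add_le _ _).trans (add_le_add h1 h2)
    have h3 : ‖∏ i ∈ A, h i‖ ≤ 1 := by
      rw [norm_prod]
      exact Finset.prod_le_one (fun _ _ => norm_nonneg _)
        fun i hi => hh i (Finset.mem_insert_of_mem hi)
    calc ‖f a * ∏ i ∈ A, f i - h a * ∏ i ∈ A, h i‖
        = ‖f a * (∏ i ∈ A, f i - ∏ i ∈ A, h i) + (f a - h a) * ∏ i ∈ A, h i‖ := by ring_nf
      _ ≤ ‖f a‖ * ‖∏ i ∈ A, f i - ∏ i ∈ A, h i‖ + ‖f a - h a‖ * ‖∏ i ∈ A, h i‖ := by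
          refine (norm_add_le _ _).trans ?_
          rw [norm_mul, norm_mul]
      _ ≤ (1 + d a) * (∏ i ∈ A, (1 + d i) - 1) + d a * 1 := by
          have := norm_nonneg (f a - h a)
          gcongr
          · linarith [norm_nonneg (f a)]
          · linarith
      _ = _ := by ring

/-- The derivative of a product is controlled by relative bounds on the derivatives. -/
lemma norm_sum_prod_erase_mul_le (A : Finset ι) {f f' : ι → ℂ} {g c : ι → ℝ}
    (hf : ∀ i ∈ A, ‖f i‖ ≤ g i) (hf' : ∀ i ∈ A, ‖f' i‖ ≤ c i * g i) :
    ‖∑ i ∈ A, (∏ j ∈ A.erase i, f j) * f' i‖ ≤ (∑ i ∈ A, c i) * ∏ i ∈ A, g i := by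
  rw [Finset.sum_mul]
  refine (norm_sum_le _ _).trans (Finset.sum_le_sum fun i hi => ?_)
  rw [norm_mul, norm_prod, ← Finset.mul_prod_erase A g hi]
  have h1 : ∏ j ∈ A.erase i, ‖f j‖ ≤ ∏ j ∈ A.erase i, g j :=
    Finset.prod_le_prod (fun _ _ => norm_nonneg _) fun j hj => hf j (Finset.mem_of_mem_erase hj)
  calc _ ≤ (∏ j ∈ A.erase i, g j) * (c i * g i) :=
        mul_le_mul h1 (hf' i hi) (norm_nonneg _)
          ((Finset.prod_nonneg fun _ _ => norm_nonneg _).trans h1)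
    _ = _ := by ring

/-- The Leibniz-rule analogue: in each summand the error splits into that of the differentiated
factor and that of the remaining product. -/
lemma norm_sum_prod_erase_sub_le (A : Finset ι) {f h f' h' : ι → ℂ} {d d' m : ι → ℝ}
    (hh : ∀ i ∈ A, ‖h i‖ ≤ 1) (hd : ∀ i ∈ A, ‖f i - h i‖ ≤ d i)
    (hd' : ∀ i ∈ A, ‖f' i - h' i‖ ≤ d' i) (hm : ∀ i ∈ A, ‖h' i‖ ≤ m i) :
    ‖∑ i ∈ A, (∏ j ∈ A.erase i, f j) * f' i - ∑ i ∈ A, (∏ j ∈ A.erase i, h j) * h' i‖ ≤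
      (∑ i ∈ A, d' i) * ∏ i ∈ A, (1 + d i) + (∑ i ∈ A, m i) * (∏ i ∈ A, (1 + d i) - 1) := by
  rw [← Finset.sum_sub_distrib, Finset.sum_mul, Finset.sum_mul, ← Finset.sum_add_distrib]
  refine (norm_sum_le _ _).trans (Finset.sum_le_sum fun i hi => ?_)
  have hd0 : ∀ j ∈ A, 0 ≤ d j := fun j hj => (norm_nonneg _).trans (hd j hj)
  have hsub : ∏ j ∈ A.erase i, (1 + d j) ≤ ∏ j ∈ A, (1 + d j) := by
    rw [← Finset.mul_prod_erase A _ hi]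
    exact le_mul_of_one_le_left (Finset.prod_nonneg fun j hj => by
      linarith [hd0 j (Finset.mem_of_mem_erase hj)]) (by linarith [hd0 i hi])
  have h1 := norm_prod_sub_prod_le (A.erase i) (fun j hj => hh j (Finset.mem_of_mem_erase hj))
    (fun j hj => hd j (Finset.mem_of_mem_erase hj))
  have h2 : ‖∏ j ∈ A.erase i, f j‖ ≤ ∏ j ∈ A.erase i, (1 + d j) := by
    rw [norm_prod]
    refine Finset.prod_le_prod (fun _ _ => norm_nonneg _) fun j hj => ?_
    have hj := Finset.mem_of_mem_erase hj
    calc ‖f j‖ = ‖h j + (f j - h j)‖ := by ring_nf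
      _ ≤ 1 + d j := (norm_add_le _ _).trans (add_le_add (hh j hj) (hd j hj))
  calc _ = ‖(∏ j ∈ A.erase i, f j) * (f' i - h' i) +
        (∏ j ∈ A.erase i, f j - ∏ j ∈ A.erase i, h j) * h' i‖ := by ring_nf
    _ ≤ ‖∏ j ∈ A.erase i, f j‖ * ‖f' i - h' i‖ +
        ‖∏ j ∈ A.erase i, f j - ∏ j ∈ A.erase i, h j‖ * ‖h' i‖ := by
        refine (norm_add_le _ _).trans ?_
        rw [norm_mul, norm_mul]
    _ ≤ (∏ j ∈ A, (1 + d j)) * d' i + (∏ j ∈ A, (1 + d j) - 1) * m i := by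
        have h3 := (norm_nonneg _).trans h1
        have h4 := (norm_nonneg _).trans h2
        exact add_le_add (mul_le_mul (h2.trans hsub) (hd' i hi) (norm_nonneg _) (h4.trans hsub))
          (mul_le_mul (h1.trans (by linarith)) (hm i hi) (norm_nonneg _) (by linarith))
    _ = _ := by ring

end ProductBounds

/-! ### Walls and intervals of sites -/

section Intervals

variable {N : ℕ}

lemma card_filter_interval {s e : ℕ} (he : e ≤ N) :
    (Finset.univ.filter fun j : Fin N => s < (j : ℕ) + 1 ∧ (j : ℕ) + 1 ≤ e).card = e - s := by
  rw [← Finset.card_map Fin.valEmbedding, ← Nat.card_Ico s e]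
  congr 1
  ext i
  simp only [Finset.mem_map, Finset.mem_filter, Finset.mem_univ, true_and, Fin.valEmbedding_apply,
    Finset.mem_Ico]
  constructor
  · rintro ⟨a, h, rfl⟩; omega
  · intro h; exact ⟨⟨i, by omega⟩, by simp; omega, rfl⟩

lemma prod_interval {s e : ℕ} (he : e ≤ N) (c : ℝ) :
    ∏ j : Fin N, (if s < (j : ℕ) + 1 ∧ (j : ℕ) + 1 ≤ e then c else 1) = c ^ (e - s) := by
  rw [← Finset.prod_filter, Finset.prod_const, card_filter_interval he]

lemma sum_interval {R : Type*} [CommRing R] {s e : ℕ} (he : e ≤ N) (c : R) :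
    ∑ j : Fin N, (if s < (j : ℕ) + 1 ∧ (j : ℕ) + 1 ≤ e then c else 0) = ((e - s : ℕ) : R) * c := by
  rw [← Finset.sum_filter, Finset.sum_const, card_filter_interval he, nsmul_eq_mul]

/-- Walls `k < l` differ exactly on the sites `k+1, …, l`. Where they agree inside the string the
factor is `δ`; where they differ outside it the factor is 0. What survives is `δ` on `s+1, …, k` and
on `l+1, …, e`. -/
lemma prod_wall_le_stringWeight {δ : ℝ} {s e k l : ℕ}
    (he : e ≤ N) (hk : k ≤ N) (hl : l ≤ N) :
    ∏ j : Fin N, (if s < (j : ℕ) + 1 ∧ (j : ℕ) + 1 ≤ e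
        then (if wallConfig N k j = wallConfig N l j then δ else 1)
        else (if wallConfig N k j = wallConfig N l j then 1 else 0)) ≤
      stringWeight δ s e k l := by
  have hsymm : stringWeight δ s e k l = stringWeight δ s e l k := by
    simp only [stringWeight, min_comm k l, max_comm k l, eq_comm (a := k)]
  wlog hkl : k ≤ l generalizing k l
  · rw [hsymm]
    simp only [eq_comm (a := wallConfig N k _)]
    exact this hl hk hsymm.symm (by omega)
  rcases hkl.eq_or_lt with rfl | hkl
  · simp only [if_true]
    rw [prod_interval he, stringWeight, if_pos rfl]
  · have hbit : ∀ j : Fin N, wallConfig N k j = wallConfig N l j ↔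
        ¬ (k < (j : ℕ) + 1 ∧ (j : ℕ) + 1 ≤ l) := by
      intro j
      simp only [wallConfig]
      split_ifs <;> omega
    simp only [hbit]
    rw [stringWeight, if_neg hkl.ne, min_eq_left hkl.le, max_eq_right hkl.le]
    split_ifs with hin
    · have e1 : ∀ j : Fin N, (if s < (j : ℕ) + 1 ∧ (j : ℕ) + 1 ≤ e
        then (if ¬ (k < (j : ℕ) + 1 ∧ (j : ℕ) + 1 ≤ l) then δ else 1)
        else (if ¬ (k < (j : ℕ) + 1 ∧ (j : ℕ) + 1 ≤ l) then 1 else 0)) =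
        (if s < (j : ℕ) + 1 ∧ (j : ℕ) + 1 ≤ k then δ else 1) *
        (if l < (j : ℕ) + 1 ∧ (j : ℕ) + 1 ≤ e then δ else 1) := by
        intro j
        split_ifs <;> first | omega | simp
      simp only [e1, Finset.prod_mul_distrib]
      rw [prod_interval hk, prod_interval he, pow_add]
    · refine le_of_eq ?_
      by_cases hks : k < s
      -- The coordinate `k` is site number `k + 1 ≤ s`, outside the string, where the bits differ;
      -- in the other case site `l > e` plays this role.
      · refine Finset.prod_eq_zero (Finset.mem_univ ⟨k, by omega⟩) ?_
        rw [if_neg (by simp; omega), if_neg (by simp; omega)]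
      · refine Finset.prod_eq_zero (Finset.mem_univ ⟨l - 1, by omega⟩) ?_
        rw [if_neg (by simp; omega), if_neg (by simp; omega)]

end Intervals

/-! ### Strings of `Y` operators after the noisy channel -/

/-- The factor of the string on the sites `s + 1, …, e` at the site `j`. -/
noncomputable def stringSite (N s e : ℕ) (φ : ℕ → ℝ) (j : Fin N) : QubitOp :=
  if s < (j : ℕ) + 1 ∧ (j : ℕ) + 1 ≤ e then rotY (φ ((j : ℕ) + 1)) else 1

/-- The string of rotated `Y` operators on the sites `s + 1, …, e`. -/
noncomputable def stringOp (N s e : ℕ) (φ : ℕ → ℝ) : ChainOp N := tensorOp (stringSite N s e φ)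

/-- The matrix element of the string, after the channel, between the walls `k` and `l`. -/
noncomputable def stringTerm (N s e : ℕ) (φ : ℕ → ℝ) (Φ : SuperOp) (k l : ℕ) : ℂ :=
  ∏ j : Fin N, siteTerm Φ (stringSite N s e φ j) (wallConfig N k j) (wallConfig N l j)

/-- The logarithmic `θ`-derivative of the noiseless matrix element on one site. -/
noncomputable def bitGap (u w : Fin 2) : ℂ := (((u : ℕ) : ℂ) - ((w : ℕ) : ℂ)) * 2 * Complex.I

lemma norm_bitGap_le (u w : Fin 2) : ‖bitGap u w‖ ≤ 2 := by
  fin_cases u <;> fin_cases w <;> simp [bitGap]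

/-- The derivative of one factor of `stringTerm`, where `D` is the derivative of the noise. -/
noncomputable def siteDeriv (N s e : ℕ) (φ : ℕ → ℝ) (D : SuperOp) (θ : ℝ) (k l : ℕ) (j : Fin N) :
    ℂ :=
  if s < (j : ℕ) + 1 ∧ (j : ℕ) + 1 ≤ e then
    siteTerm D (rotY (φ ((j : ℕ) + 1))) (wallConfig N k j) (wallConfig N l j) +
      bitGap (wallConfig N k j) (wallConfig N l j) * siteTerm (idealSensing θ)
        (rotY (φ ((j : ℕ) + 1))) (wallConfig N k j) (wallConfig N l j)
  else 0

/-- The derivative of `stringTerm`. -/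
noncomputable def stringDeriv (N s e : ℕ) (φ : ℕ → ℝ) (Φ D : SuperOp) (θ : ℝ) (k l : ℕ) : ℂ :=
  ∑ i : Fin N, (∏ j ∈ Finset.univ.erase i,
    siteTerm Φ (stringSite N s e φ j) (wallConfig N k j) (wallConfig N l j)) *
      siteDeriv N s e φ D θ k l i

section StringBounds

variable {N s e : ℕ} {φ : ℕ → ℝ}

/-- On the string the derivative is that of the noise plus that of the ideal phase. Off the string
the factor is constant in `t`, as every `Φ t` preserves the trace. -/
lemma hasDerivAt_stringTerm {Φ : ℝ → SuperOp} {D : SuperOp} {θ : ℝ} (hΦ : ∀ t, IsChannel (Φ t))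
    (hD : HasSuperDerivAt (fun t => Φ t - idealSensing t) D θ) (k l : ℕ) :
    HasDerivAt (fun t => stringTerm N s e φ (Φ t) k l) (stringDeriv N s e φ (Φ θ) D θ k l) θ := by
  have h : ∀ j ∈ (Finset.univ : Finset (Fin N)), HasDerivAt (fun t => siteTerm (Φ t)
      (stringSite N s e φ j) (wallConfig N k j) (wallConfig N l j))
      (siteDeriv N s e φ D θ k l j) θ := by
    intro j _
    unfold stringSite siteDeriv
    split_ifs
    · have := (hD.siteTerm (φ ((j : ℕ) + 1)) (wallConfig N k j) (wallConfig N l j)).add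
        (hasDerivAt_siteTerm_idealSensing θ (φ ((j : ℕ) + 1)) (wallConfig N k j) (wallConfig N l j))
      refine HasDerivAt.congr_of_eventuallyEq this (Filter.Eventually.of_forall fun t => ?_)
      simp [siteTerm_sub]
    · simp only [siteTerm_one (hΦ _)]
      exact hasDerivAt_const _ _
  have := HasDerivAt.fun_finsetProd h
  simpa only [stringTerm, stringDeriv, smul_eq_mul] using this

variable {Φ D : SuperOp} {θ b : ℝ}

/-- Entrywise noise bounds for one factor. -/
lemma norm_siteTerm_sub_ideal_le (hb : 0 ≤ b)
    (h : diamondNorm (Φ - idealSensing θ) ≤ ENNReal.ofReal b) (φ : ℝ) (u w : Fin 2) :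
    ‖siteTerm Φ (rotY φ) u w - siteTerm (idealSensing θ) (rotY φ) u w‖ ≤ 4 * b := by
  rw [← siteTerm_sub]
  exact norm_siteTerm_rotY_le hb h φ u w

/-- The bound for the modulus of one factor. -/
noncomputable def siteBound (N s e : ℕ) (δ : ℝ) (k l : ℕ) (j : Fin N) : ℝ :=
  (if s < (j : ℕ) + 1 ∧ (j : ℕ) + 1 ≤ e then 1 + δ else 1) *
    (if s < (j : ℕ) + 1 ∧ (j : ℕ) + 1 ≤ e
        then (if wallConfig N k j = wallConfig N l j then δ else 1)
        else (if wallConfig N k j = wallConfig N l j then 1 else 0))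

lemma prod_siteBound_le {δ : ℝ} (h0 : 0 ≤ δ) {k l : ℕ}
    (he : e ≤ N) (hk : k ≤ N) (hl : l ≤ N) :
    ∏ j : Fin N, siteBound N s e δ k l j ≤ (1 + δ) ^ (e - s) * stringWeight δ s e k l := by
  simp only [siteBound, Finset.prod_mul_distrib]
  rw [prod_interval he]
  gcongr
  exact prod_wall_le_stringWeight he hk hl

lemma norm_siteTerm_le_siteBound (hΦ : IsChannel Φ) (hb : 0 ≤ b)
    (h : diamondNorm (Φ - idealSensing θ) ≤ ENNReal.ofReal b) (k l : ℕ) (j : Fin N) :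
    ‖siteTerm Φ (stringSite N s e φ j) (wallConfig N k j) (wallConfig N l j)‖ ≤
      siteBound N s e (4 * b) k l j := by
  unfold stringSite siteBound
  by_cases hj : s < (j : ℕ) + 1 ∧ (j : ℕ) + 1 ≤ e
  · rw [if_pos hj, if_pos hj, if_pos hj]
    have h1 := norm_siteTerm_sub_ideal_le hb h (φ ((j : ℕ) + 1)) (wallConfig N k j)
      (wallConfig N l j)
    have h2 := norm_siteTerm_idealSensing θ (φ ((j : ℕ) + 1)) (wallConfig N k j)
      (wallConfig N l j)
    have h3 := norm_le_norm_add_norm_sub' (siteTerm Φ (rotY (φ ((j : ℕ) + 1))) (wallConfig N k j)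
      (wallConfig N l j)) (siteTerm (idealSensing θ) (rotY (φ ((j : ℕ) + 1))) (wallConfig N k j)
      (wallConfig N l j))
    split_ifs at h2 ⊢
    · nlinarith
    · linarith
  · rw [if_neg hj, if_neg hj, if_neg hj, siteTerm_one hΦ]
    split_ifs <;> simp

/-- With equal bits the ideal part vanishes and only the noise `4b` remains; with different bits `4b
+ 2 ≤ 3(1 + 4b)`. Measuring the derivative relative to `siteBound` preserves the decay in `δ` under
the Leibniz rule. -/
lemma norm_siteDeriv_le_siteBound (hb : 0 ≤ b)
    (hD : diamondNorm D ≤ ENNReal.ofReal b) (k l : ℕ) (j : Fin N) :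
    ‖siteDeriv N s e φ D θ k l j‖ ≤
      (if s < (j : ℕ) + 1 ∧ (j : ℕ) + 1 ≤ e then 3 else 0) * siteBound N s e (4 * b) k l j := by
  unfold siteDeriv siteBound
  by_cases hj : s < (j : ℕ) + 1 ∧ (j : ℕ) + 1 ≤ e
  · simp only [if_pos hj]
    refine (norm_add_le _ _).trans ?_
    have h1 := norm_siteTerm_rotY_le hb hD (φ ((j : ℕ) + 1)) (wallConfig N k j)
      (wallConfig N l j)
    rw [norm_mul, norm_siteTerm_idealSensing]
    have h2 := norm_bitGap_le (wallConfig N k j) (wallConfig N l j)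
    split_ifs
    · nlinarith
    · linarith
  · simp only [if_neg hj, norm_zero, zero_mul, le_refl]

lemma norm_stringTerm_le (hΦ : IsChannel Φ) (hb : 0 ≤ b)
    (h : diamondNorm (Φ - idealSensing θ) ≤ ENNReal.ofReal b) {k l : ℕ}
    (he : e ≤ N) (hk : k ≤ N) (hl : l ≤ N) :
    ‖stringTerm N s e φ Φ k l‖ ≤ (1 + 4 * b) ^ (e - s) * stringWeight (4 * b) s e k l := by
  refine le_trans ?_ (prod_siteBound_le (by positivity) he hk hl)
  rw [stringTerm, norm_prod]
  exact Finset.prod_le_prod (fun _ _ => norm_nonneg _)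
    fun j _ => norm_siteTerm_le_siteBound hΦ hb h k l j

lemma norm_stringDeriv_le (hΦ : IsChannel Φ) (hb : 0 ≤ b)
    (h : diamondNorm (Φ - idealSensing θ) ≤ ENNReal.ofReal b)
    (hD : diamondNorm D ≤ ENNReal.ofReal b) {k l : ℕ}
    (he : e ≤ N) (hk : k ≤ N) (hl : l ≤ N) :
    ‖stringDeriv N s e φ Φ D θ k l‖ ≤
      3 * ((e - s : ℕ) : ℝ) * ((1 + 4 * b) ^ (e - s) * stringWeight (4 * b) s e k l) := by
  refine (norm_sum_prod_erase_mul_le _ (fun j _ => norm_siteTerm_le_siteBound hΦ hb h k l j)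
    (fun j _ => norm_siteDeriv_le_siteBound hb hD k l j)).trans ?_
  rw [sum_interval he, mul_comm (3 : ℝ)]
  gcongr
  exact prod_siteBound_le (by positivity) he hk hl

/-- The noiseless phase of the matrix element between the walls `e` and `s`. -/
noncomputable def stringPhase (φ : ℕ → ℝ) (θ : ℝ) (s e : ℕ) : ℝ :=
  ∑ j ∈ Finset.Ioc s e, (2 * θ - φ j - Real.pi / 2)

/-- Noiseless factor of the string between the walls that delimit it. -/
noncomputable def idealSite (N s e : ℕ) (φ : ℕ → ℝ) (θ : ℝ) (k l : ℕ) (j : Fin N) : ℂ :=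
  if s < (j : ℕ) + 1 ∧ (j : ℕ) + 1 ≤ e then
    siteTerm (idealSensing θ) (rotY (φ ((j : ℕ) + 1))) (wallConfig N k j) (wallConfig N l j)
  else 1

lemma wallConfig_eq_iff_not_mem_interval (hse : s < e) {k l : ℕ}
    (hkl : (k = e ∧ l = s) ∨ (k = s ∧ l = e)) (j : Fin N) :
    wallConfig N k j = wallConfig N l j ↔ ¬ (s < (j : ℕ) + 1 ∧ (j : ℕ) + 1 ≤ e) := by
  rcases hkl with ⟨rfl, rfl⟩ | ⟨rfl, rfl⟩ <;> simp only [wallConfig] <;> split_ifs <;>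
    omega

lemma norm_idealSite_le (k l : ℕ) (j : Fin N) : ‖idealSite N s e φ θ k l j‖ ≤ 1 := by
  unfold idealSite
  split_ifs
  · rw [norm_siteTerm_idealSensing]; split_ifs <;> norm_num
  · simp

lemma norm_siteTerm_sub_idealSite_le (hΦ : IsChannel Φ) (hb : 0 ≤ b)
    (h : diamondNorm (Φ - idealSensing θ) ≤ ENNReal.ofReal b) (hse : s < e) {k l : ℕ}
    (hkl : (k = e ∧ l = s) ∨ (k = s ∧ l = e)) (j : Fin N) :
    ‖siteTerm Φ (stringSite N s e φ j) (wallConfig N k j) (wallConfig N l j) -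
      idealSite N s e φ θ k l j‖ ≤ if s < (j : ℕ) + 1 ∧ (j : ℕ) + 1 ≤ e then 4 * b else 0 := by
  unfold stringSite idealSite
  by_cases hj : s < (j : ℕ) + 1 ∧ (j : ℕ) + 1 ≤ e
  · simp only [if_pos hj]
    exact norm_siteTerm_sub_ideal_le hb h _ _ _
  · simp only [if_neg hj]
    rw [siteTerm_one hΦ, if_pos ((wallConfig_eq_iff_not_mem_interval hse hkl j).2 hj)]
    simp

lemma prod_one_add_interval (he : e ≤ N) (δ : ℝ) :
    ∏ j : Fin N, (1 + if s < (j : ℕ) + 1 ∧ (j : ℕ) + 1 ≤ e then δ else 0) = (1 + δ) ^ (e - s) := by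
  rw [← prod_interval he]
  refine Finset.prod_congr rfl fun j _ => ?_
  split_ifs <;> simp

lemma norm_stringTerm_sub_ideal_le (hΦ : IsChannel Φ) (hb : 0 ≤ b)
    (h : diamondNorm (Φ - idealSensing θ) ≤ ENNReal.ofReal b) (hse : s < e) (he : e ≤ N) {k l : ℕ}
    (hkl : (k = e ∧ l = s) ∨ (k = s ∧ l = e)) :
    ‖stringTerm N s e φ Φ k l - ∏ j : Fin N, idealSite N s e φ θ k l j‖ ≤
      (1 + 4 * b) ^ (e - s) - 1 := by
  rw [← prod_one_add_interval he]
  exact norm_prod_sub_prod_le _ (fun j _ => norm_idealSite_le k l j)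
    fun j _ => norm_siteTerm_sub_idealSite_le hΦ hb h hse hkl j

/-- Between the delimiting walls every string site has the same logarithmic derivative, `2i` or
`-2i`. These add up coherently to the factor `e - s`, the source of the `T²` scaling. -/
lemma norm_stringDeriv_sub_ideal_le (hΦ : IsChannel Φ) (hb : 0 ≤ b)
    (h : diamondNorm (Φ - idealSensing θ) ≤ ENNReal.ofReal b)
    (hD : diamondNorm D ≤ ENNReal.ofReal b) (hse : s < e) (he : e ≤ N) {k l : ℕ}
    (hkl : (k = e ∧ l = s) ∨ (k = s ∧ l = e)) :
    ‖stringDeriv N s e φ Φ D θ k l - ((e - s : ℕ) : ℂ) *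
        ((if k = e then 1 else -1) * 2 * Complex.I) * ∏ j : Fin N, idealSite N s e φ θ k l j‖ ≤
      ((e - s : ℕ) : ℝ) * (4 * b * (1 + 4 * b) ^ (e - s) + 2 * ((1 + 4 * b) ^ (e - s) - 1)) := by
  have hgap : ∀ j : Fin N, (s < (j : ℕ) + 1 ∧ (j : ℕ) + 1 ≤ e) →
      bitGap (wallConfig N k j) (wallConfig N l j) = (if k = e then 1 else -1) * 2 * Complex.I := by
    intro j hj
    rcases hkl with ⟨rfl, rfl⟩ | ⟨rfl, rfl⟩
    · simp [bitGap, wallConfig, hj.2, not_le.2 hj.1]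
    · simp [bitGap, wallConfig, hj.2, not_le.2 hj.1, hse.ne]
  have hid : ((e - s : ℕ) : ℂ) * ((if k = e then 1 else -1) * 2 * Complex.I) *
      ∏ j : Fin N, idealSite N s e φ θ k l j =
      ∑ i : Fin N, (∏ j ∈ Finset.univ.erase i, idealSite N s e φ θ k l j) *
        (if s < (i : ℕ) + 1 ∧ (i : ℕ) + 1 ≤ e then
          bitGap (wallConfig N k i) (wallConfig N l i) * idealSite N s e φ θ k l i else 0) := by
    rw [← sum_interval he, Finset.sum_mul]
    refine Finset.sum_congr rfl fun i hi => ?_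
    rw [← Finset.mul_prod_erase _ _ hi]
    by_cases h1 : s < (i : ℕ) + 1 ∧ (i : ℕ) + 1 ≤ e
    · rw [if_pos h1, if_pos h1, hgap i h1]; ring
    · rw [if_neg h1, if_neg h1]; ring
  rw [hid]
  refine (norm_sum_prod_erase_sub_le _ (fun j _ => norm_idealSite_le k l j)
    (fun j _ => norm_siteTerm_sub_idealSite_le hΦ hb h hse hkl j)
    (d' := fun j : Fin N => if s < (j : ℕ) + 1 ∧ (j : ℕ) + 1 ≤ e then 4 * b else 0)
    (m := fun j : Fin N => if s < (j : ℕ) + 1 ∧ (j : ℕ) + 1 ≤ e then 2 else 0) ?_ ?_).trans ?_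
  · intro j _
    unfold siteDeriv idealSite
    by_cases hj : s < (j : ℕ) + 1 ∧ (j : ℕ) + 1 ≤ e
    · simp only [if_pos hj, add_sub_cancel_right]
      exact norm_siteTerm_rotY_le hb hD _ _ _
    · simp only [if_neg hj, sub_zero, norm_zero, le_refl]
  · intro j _
    split_ifs
    · rw [norm_mul]
      have h1 := norm_bitGap_le (wallConfig N k j) (wallConfig N l j)
      have h2 := norm_idealSite_le (N := N) (s := s) (e := e) (φ := φ) (θ := θ) k l j
      nlinarith [norm_nonneg (idealSite N s e φ θ k l j),
        norm_nonneg (bitGap (wallConfig N k j) (wallConfig N l j))]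
    · simp
  · rw [prod_one_add_interval he, sum_interval he, sum_interval he]
    exact le_of_eq (by ring)

lemma prod_idealSite_wall (hse : s < e) (he : e ≤ N) :
    ∏ j : Fin N, idealSite N s e φ θ e s j = Complex.exp ((stringPhase φ θ s e : ℝ) * Complex.I) ∧
    ∏ j : Fin N, idealSite N s e φ θ s e j =
      Complex.exp (-((stringPhase φ θ s e : ℝ) * Complex.I)) := by
  have hI : ∀ f : ℕ → ℂ, ∏ j : Fin N, (if s < (j : ℕ) + 1 ∧ (j : ℕ) + 1 ≤ e
      then f ((j : ℕ) + 1) else 1) = ∏ i ∈ Finset.Ioc s e, f i := by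
    intro f
    rw [Fin.prod_univ_eq_prod_range
      (fun j => if s < j + 1 ∧ j + 1 ≤ e then f (j + 1) else 1) N, ← Finset.prod_filter,
      ← Finset.prod_image (f := f) (g := fun j => j + 1) (by intro a _ b _ h; simpa using h)]
    refine Finset.prod_congr ?_ fun _ _ => rfl
    ext i
    simp only [Finset.mem_image, Finset.mem_filter, Finset.mem_range, Finset.mem_Ioc]
    constructor
    · rintro ⟨a, ⟨_, h⟩, rfl⟩; exact h
    · rintro ⟨h1, h2⟩; exact ⟨i - 1, by omega, by omega⟩
  constructor
  · rw [stringPhase, Complex.ofReal_sum, Finset.sum_mul, Complex.exp_sum, ← hI]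
    refine Finset.prod_congr rfl fun j _ => ?_
    unfold idealSite
    split_ifs with hj
    · rw [siteTerm_idealSensing, if_neg (by
        rw [wallConfig_eq_iff_not_mem_interval hse (Or.inl ⟨rfl, rfl⟩)]; simpa using hj)]
      simp [wallConfig, hj.2, not_le.2 hj.1]
    · rfl
  · rw [stringPhase, Complex.ofReal_sum, Finset.sum_mul, ← Finset.sum_neg_distrib, Complex.exp_sum,
      ← hI]
    refine Finset.prod_congr rfl fun j _ => ?_
    unfold idealSite
    split_ifs with hj
    · rw [siteTerm_idealSensing, if_neg (by
        rw [wallConfig_eq_iff_not_mem_interval hse (Or.inr ⟨rfl, rfl⟩)]; simpa using hj)]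
      simp [wallConfig, hj.2, not_le.2 hj.1]
      ring_nf
    · rfl

end StringBounds

/-! ### Comparison of weighted string sums with their noiseless values -/

/-- If the matrix elements away from the delimiting walls are small, a weighted sum of string
expectation values is close to the contribution of the delimiting walls. -/
lemma abs_weighted_sum_sub_le {n : ℕ} {δ C ζ : ℝ} (h0 : 0 ≤ δ) (h1 : δ ≤ 1 / 2) (hC : 0 ≤ C)
    (hζ : 0 ≤ ζ) {x y : ℕ → ℝ} {α : ℕ → ℂ} {P : ℕ → ℕ → ℕ → ℕ → ℂ} {q : ℕ → ℕ → ℝ}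
    (hx : ∀ i, 0 ≤ x i) (hy : ∀ i, 0 ≤ y i)
    (hx1 : ∑ i ∈ Finset.range n, x i ^ 2 ≤ 1) (hy1 : ∑ i ∈ Finset.range n, y i ^ 2 ≤ 1)
    (hα : ∑ i ∈ Finset.range n, ‖α i‖ ^ 2 ≤ 2)
    (hxα : ∑ i ∈ Finset.range n, x i * ‖α i‖ ≤ 1) (hyα : ∑ i ∈ Finset.range n, y i * ‖α i‖ ≤ 1)
    (hP : ∀ s e k l, s < e → e < n → k < n → l < n → y e ≠ 0 →
      ‖P s e k l‖ ≤ C * stringWeight δ s e k l)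
    (hM : ∀ s e, s < e → e < n → x s ≠ 0 → y e ≠ 0 →
      |(α s * star (α e) * P s e s e).re - ‖α s‖ * ‖α e‖ * q s e| ≤ ‖α s‖ * ‖α e‖ * ζ ∧
      |(α e * star (α s) * P s e e s).re - ‖α s‖ * ‖α e‖ * q s e| ≤ ‖α s‖ * ‖α e‖ * ζ) :
    |∑ s ∈ Finset.range n, ∑ e ∈ Finset.range n, (if s < e then x s * y e *
        (1 / 2 * (∑ k ∈ Finset.range n, ∑ l ∈ Finset.range n,
          α k * star (α l) * P s e k l).re) else 0) -
      ∑ s ∈ Finset.range n, ∑ e ∈ Finset.range n, (if s < e then x s * y e *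
        (‖α s‖ * ‖α e‖ * q s e) else 0)| ≤ 20 * C * δ + ζ := by
  set R := Finset.range n with hR
  let W : ℕ → ℕ → ℝ := fun s e => ∑ k ∈ R, ∑ l ∈ R,
    (if (k = s ∧ l = e) ∨ (k = e ∧ l = s) then 0 else ‖α k‖ * ‖α l‖ * stringWeight δ s e k l)
  have hW : ∀ s e, 0 ≤ W s e := fun s e => Finset.sum_nonneg fun k _ =>
    Finset.sum_nonneg fun l _ => by
      have := stringWeight_nonneg h0 s e k l
      split_ifs <;> positivity
  have hpt : ∀ s ∈ R, ∀ e ∈ R,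
      |(if s < e then x s * y e * (1 / 2 * (∑ k ∈ R, ∑ l ∈ R,
          α k * star (α l) * P s e k l).re) else 0) -
        (if s < e then x s * y e * (‖α s‖ * ‖α e‖ * q s e) else 0)| ≤
      C / 2 * (if s < e then x s * y e * W s e else 0) +
        ζ * ((x s * ‖α s‖) * (y e * ‖α e‖)) := by
    intro s hs e he
    have hs' := Finset.mem_range.1 hs
    have he' := Finset.mem_range.1 he
    have hnn : 0 ≤ ζ * ((x s * ‖α s‖) * (y e * ‖α e‖)) :=
      mul_nonneg hζ (mul_nonneg (mul_nonneg (hx s) (norm_nonneg _))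
        (mul_nonneg (hy e) (norm_nonneg _)))
    split_ifs with hse
    · by_cases hxs : x s = 0
      · simp [hxs]
      by_cases hye : y e = 0
      · simp [hye]
      set g : ℕ → ℕ → ℂ := fun k l => α k * star (α l) * P s e k l with hg
      -- The two orders of the delimiting pair are separated from the rest. Each has main part `‖α
      -- s‖ ‖α e‖ q s e`, and the prefactor `1/2` averages them.
      have hsplit : ∑ k ∈ R, ∑ l ∈ R, g k l =
          ∑ k ∈ R, ∑ l ∈ R, (if (k = s ∧ l = e) ∨ (k = e ∧ l = s) then 0 else g k l) +
          (g s e + g e s) := by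
        have h2 : ∀ a ∈ R, ∀ b ∈ R, ∑ k ∈ R, ∑ l ∈ R, (if k = a ∧ l = b then g k l else 0)
            = g a b := by
          intro a ha b hb
          simp only [ite_and, Finset.sum_ite_irrel, Finset.sum_const_zero]
          simp [ha, hb]
        rw [← h2 s hs e he, ← h2 e he s hs]
        simp only [← Finset.sum_add_distrib]
        refine Finset.sum_congr rfl fun k _ => Finset.sum_congr rfl fun l _ => ?_
        by_cases c1 : k = s ∧ l = e
        · have c2 : ¬ (k = e ∧ l = s) := by omega
          simp only [c1, true_or, if_true, and_self]
          have : ¬ (s = e ∧ e = s) := by omega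
          simp [this]
        · by_cases c2 : k = e ∧ l = s
          · have : ¬ (e = s ∧ s = e) := by omega
            simp [c2, this]
          · simp [c1, c2]
      have herr : ‖∑ k ∈ R, ∑ l ∈ R,
          (if (k = s ∧ l = e) ∨ (k = e ∧ l = s) then 0 else g k l)‖ ≤ C * W s e := by
        refine (norm_sum_le _ _).trans ?_
        simp only [W]
        rw [Finset.mul_sum]
        refine Finset.sum_le_sum fun k hk => ?_
        refine (norm_sum_le _ _).trans ?_
        rw [Finset.mul_sum]
        refine Finset.sum_le_sum fun l hl => ?_
        split_ifs
        · simp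
        · simp only [hg, norm_mul, norm_star]
          have := hP s e k l hse he' (Finset.mem_range.1 hk) (Finset.mem_range.1 hl) hye
          calc ‖α k‖ * ‖α l‖ * ‖P s e k l‖ ≤ ‖α k‖ * ‖α l‖ * (C * stringWeight δ s e k l) := by
                gcongr
            _ = _ := by ring
      obtain ⟨m1, m2⟩ := hM s e hse he' hxs hye
      have hre := (Complex.abs_re_le_norm _).trans herr
      have key : |1 / 2 * (∑ k ∈ R, ∑ l ∈ R, g k l).re - ‖α s‖ * ‖α e‖ * q s e| ≤
          C / 2 * W s e + ‖α s‖ * ‖α e‖ * ζ := by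
        rw [hsplit, Complex.add_re, Complex.add_re]
        simp only [hg] at hre ⊢
        rw [abs_le] at m1 m2 hre ⊢
        constructor <;> linarith [m1.1, m1.2, m2.1, m2.2, hre.1, hre.2]
      rw [← mul_sub, abs_mul, abs_of_nonneg (mul_nonneg (hx s) (hy e))]
      calc _ ≤ x s * y e * (C / 2 * W s e + ‖α s‖ * ‖α e‖ * ζ) :=
            mul_le_mul_of_nonneg_left key (mul_nonneg (hx s) (hy e))
        _ = _ := by ring
    · simpa using hnn
  have hK := sum_stringWeight_le (n := n) h0 h1 hx hy (fun i => norm_nonneg (α i)) hx1 hy1 hα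
  rw [← Finset.sum_sub_distrib]
  simp only [← Finset.sum_sub_distrib]
  refine (Finset.abs_sum_le_sum_abs _ _).trans ((Finset.sum_le_sum fun s hs =>
    (Finset.abs_sum_le_sum_abs _ _).trans (Finset.sum_le_sum fun e he => hpt s hs e he)).trans ?_)
  simp only [Finset.sum_add_distrib, ← Finset.mul_sum, ← Finset.sum_mul]
  have hx0 : 0 ≤ ∑ i ∈ R, x i * ‖α i‖ := Finset.sum_nonneg fun i _ =>
    mul_nonneg (hx i) (norm_nonneg _)
  have hy0 : 0 ≤ ∑ i ∈ R, y i * ‖α i‖ := Finset.sum_nonneg fun i _ =>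
    mul_nonneg (hy i) (norm_nonneg _)
  have e1 : C / 2 * ∑ s ∈ R, ∑ e ∈ R, (if s < e then x s * y e * W s e else 0) ≤
      C / 2 * (40 * δ) := by
    gcongr
  have e2 : ζ * ((∑ i ∈ R, x i * ‖α i‖) * ∑ i ∈ R, y i * ‖α i‖) ≤ ζ * 1 := by
    gcongr
    exact mul_le_one₀ hxα hy0 hyα
  linarith

/-! ### Alignment of the phases -/

section Phases

variable {N : ℕ} {T θpr : ℝ} {φ : ℕ → ℝ}

lemma exists_isAligned (N : ℕ) (T θpr : ℝ) : ∃ φ : ℕ → ℝ, IsAligned N T θpr φ := by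
  -- `ψ i` is the total phase required on the first `i` sites. The on-site phases are its
  -- increments, and `ψ 0 = 0` makes the sum telescope.
  let ψ : ℕ → ℝ := fun i => if i = 0 then 0 else
    Complex.arg (amp N T i) - (-(Real.pi / 2) * (1 - (i : ℝ)) - 2 * θpr * (i : ℝ))
  refine ⟨fun j => ψ j - ψ (j - 1), fun i hi => ?_⟩
  have hi := (Finset.mem_Icc.1 hi).1
  have hsum : ∑ j ∈ Finset.Icc 1 i, (ψ j - ψ (j - 1)) = ψ i := by
    have : Finset.Icc 1 i = Finset.Ico (0 + 1) (i + 1) := by ext; simp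
    rw [this, ← Finset.sum_Ico_add' (fun j => ψ j - ψ (j - 1)) 0 i 1, ← Finset.range_eq_Ico]
    simp only [Nat.add_sub_cancel]
    rw [Finset.sum_range_sub]
    simp [ψ]
  rw [rotAmp, hsum]
  conv_lhs => rw [← Complex.norm_mul_exp_arg_mul_I (amp N T i)]
  rw [mul_left_comm, ← Complex.exp_add]
  congr 2
  simp only [ψ, if_neg (show i ≠ 0 by omega)]
  push_cast
  ring

/-- The argument of the amplitude of the wall `k`. -/
noncomputable def wallPhase (θpr : ℝ) (φ : ℕ → ℝ) (k : ℕ) : ℝ :=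
  ∑ j ∈ Finset.Icc 1 k, φ j + (Real.pi / 2 - 2 * θpr) * k - if k = 0 then 0 else Real.pi / 2

lemma IsAligned.wallAmp_eq (h : IsAligned N T θpr φ) {k : ℕ} (hk : k ≤ N) :
    wallAmp N T k = ‖wallAmp N T k‖ * Complex.exp ((wallPhase θpr φ k : ℝ) * Complex.I) := by
  by_cases hk0 : k = 0
  · subst hk0
    simp [wallAmp, wallPhase]
  · have h1 := h k (Finset.mem_Icc.2 ⟨by omega, hk⟩)
    simp only [wallAmp, if_neg hk0, wallPhase]
    rw [rotAmp] at h1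
    have h2 : amp N T k = Complex.exp (Complex.I * ((∑ j ∈ Finset.Icc 1 k, φ j : ℝ) : ℂ)) *
        (Complex.exp (-Complex.I * ((∑ j ∈ Finset.Icc 1 k, φ j : ℝ) : ℂ)) * amp N T k) := by
      rw [← mul_assoc, ← Complex.exp_add]
      simp
    rw [h1, mul_left_comm, ← Complex.exp_add] at h2
    refine h2.trans ?_
    congr 2
    push_cast
    ring

/-- The phase of the noiseless contribution of the delimiting walls of a string. -/
noncomputable def signalPhase (θpr θ : ℝ) (s e : ℕ) : ℝ :=
  2 * (θ - θpr) * ((e : ℝ) - s) - if s = 0 then Real.pi / 2 else 0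

/-- The basis phases cancel, as does `π/2` per site. The wall `0`, whose amplitude is 1, lacks the
offset `-π/2` of the other walls; this turns cosine into sine for strings starting at the first site
and puts `θpr` at the point of steepest slope. -/
lemma wallPhase_sub_add_stringPhase (θ : ℝ) {s e : ℕ} (hse : s < e) :
    wallPhase θpr φ e - wallPhase θpr φ s + stringPhase φ θ s e = signalPhase θpr θ s e := by
  have h : ∑ j ∈ Finset.Icc 1 e, φ j = ∑ j ∈ Finset.Icc 1 s, φ j + ∑ j ∈ Finset.Ioc s e, φ j := by
    have h2 : ∀ m, Finset.Icc 1 m = Finset.Ioc 0 m := fun m => by ext; simp; omega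
    rw [h2, h2, Finset.sum_Ioc_consecutive φ (Nat.zero_le s) hse.le]
  simp only [wallPhase, stringPhase, signalPhase, Finset.sum_sub_distrib, Finset.sum_const,
    Nat.card_Ioc, nsmul_eq_mul, if_neg (show e ≠ 0 by omega)]
  rw [Nat.cast_sub hse.le, h]
  split_ifs <;> ring

lemma IsAligned.mul_prod_idealSite (h : IsAligned N T θpr φ) (θ : ℝ) {s e : ℕ} (hse : s < e)
    (he : e ≤ N) :
    wallAmp N T e * star (wallAmp N T s) * ∏ j : Fin N, idealSite N s e φ θ e s j =
      ((‖wallAmp N T s‖ * ‖wallAmp N T e‖ : ℝ) : ℂ) *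
        Complex.exp ((signalPhase θpr θ s e : ℝ) * Complex.I) ∧
    wallAmp N T s * star (wallAmp N T e) * ∏ j : Fin N, idealSite N s e φ θ s e j =
      ((‖wallAmp N T s‖ * ‖wallAmp N T e‖ : ℝ) : ℂ) *
        Complex.exp ((-signalPhase θpr θ s e : ℝ) * Complex.I) := by
  have e1 := h.wallAmp_eq he
  have e2 := h.wallAmp_eq (hse.le.trans he)
  have e1' : star (wallAmp N T e) =
      ‖wallAmp N T e‖ * Complex.exp (-((wallPhase θpr φ e : ℝ) * Complex.I)) := by
    conv_lhs => rw [e1]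
    simp [← Complex.exp_conj]
  have e2' : star (wallAmp N T s) =
      ‖wallAmp N T s‖ * Complex.exp (-((wallPhase θpr φ s : ℝ) * Complex.I)) := by
    conv_lhs => rw [e2]
    simp [← Complex.exp_conj]
  obtain ⟨p1, p2⟩ := prod_idealSite_wall (φ := φ) (θ := θ) hse he
  rw [← wallPhase_sub_add_stringPhase (φ := φ) θ hse]
  constructor
  · rw [p1, e2']
    conv_lhs => rw [e1]
    rw [show ((wallPhase θpr φ e - wallPhase θpr φ s + stringPhase φ θ s e : ℝ) : ℂ) * Complex.I =
      (wallPhase θpr φ e : ℝ) * Complex.I + -((wallPhase θpr φ s : ℝ) * Complex.I) +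
        (stringPhase φ θ s e : ℝ) * Complex.I by push_cast; ring, Complex.exp_add, Complex.exp_add]
    push_cast
    ring
  · rw [p2, e1']
    conv_lhs => rw [e2]
    rw [show ((-(wallPhase θpr φ e - wallPhase θpr φ s + stringPhase φ θ s e) : ℝ) : ℂ) *
      Complex.I = (wallPhase θpr φ s : ℝ) * Complex.I + -((wallPhase θpr φ e : ℝ) * Complex.I) +
        -((stringPhase φ θ s e : ℝ) * Complex.I) by push_cast; ring, Complex.exp_add,
        Complex.exp_add]
    push_cast
    ring

end Phases

/-! ### The observable and its square as sums of strings -/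

section Observable

variable {N : ℕ} {v T : ℝ} {φ : ℕ → ℝ}

lemma rotYString_eq (i : ℕ) : rotYString N φ i = stringOp N 0 i φ := by
  unfold rotYString stringOp stringSite
  simp

lemma stringOp_self (i : ℕ) : stringOp N i i φ = tensorOp fun _ => 1 := by
  unfold stringOp stringSite
  congr 1
  funext j
  rw [if_neg (by omega)]

/-- On the common sites `Y² = 1`, so only the sites between the two ends remain. -/
lemma stringOp_mul_of_le {i j : ℕ} (h : i ≤ j) :
    stringOp N 0 i φ * stringOp N 0 j φ = stringOp N i j φ ∧
    stringOp N 0 j φ * stringOp N 0 i φ = stringOp N i j φ := by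
  unfold stringOp
  rw [tensorOp_mul, tensorOp_mul]
  constructor <;>
  · congr 1
    funext m
    unfold stringSite
    split_ifs <;> first | omega | simp [rotY_mul_self]

lemma expect_sum_smul (ρ : ChainOp N) (A : Finset ℕ) (c : ℕ → ℝ) (O : ℕ → ChainOp N) :
    expect ρ (∑ i ∈ A, (c i : ℂ) • O i) = ∑ i ∈ A, c i * expect ρ (O i) := by
  simp only [expect, Finset.mul_sum, Matrix.trace_sum, Matrix.mul_smul, Matrix.trace_smul,
    smul_eq_mul, Complex.re_sum, Complex.re_ofReal_mul]

/-- The weights of the observable, extended by zero. -/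
noncomputable def windowWeight (N : ℕ) (v T : ℝ) (i : ℕ) : ℝ :=
  if i ∈ window N v T then ‖amp N T i‖ else 0

lemma sum_windowWeight_mul {M : Type*} [AddCommMonoid M] (f : ℕ → ℝ → M) (hf : ∀ i, f i 0 = 0) :
    ∑ i ∈ Finset.range (N + 1), f i (windowWeight N v T i) =
      ∑ i ∈ window N v T, f i ‖amp N T i‖ := by
  have hsub : window N v T ⊆ Finset.range (N + 1) := by
    intro i hi
    have := Finset.mem_Icc.1 (Finset.mem_filter.1 hi).1
    simp; omega
  rw [← Finset.sum_subset hsub]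
  · refine Finset.sum_congr rfl fun i hi => ?_
    rw [windowWeight, if_pos hi]
  · intro i _ hi
    rw [windowWeight, if_neg hi, hf]

lemma dominoO_eq : dominoO N v T φ =
    ∑ i ∈ Finset.range (N + 1), (windowWeight N v T i : ℂ) • stringOp N 0 i φ := by
  rw [sum_windowWeight_mul (fun i r => (r : ℂ) • stringOp N 0 i φ) (by simp), dominoO]
  simp only [rotYString_eq]

/-- The redundant sum over `s`, with weight the indicator of `s = 0`, gives the mean the same shape
as the second moment, so that one estimate serves both. -/
lemma expect_dominoO (ρ : ChainOp N) : expect ρ (dominoO N v T φ) =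
    ∑ s ∈ Finset.range (N + 1), ∑ e ∈ Finset.range (N + 1), (if s < e then
      (if s = 0 then 1 else 0) * windowWeight N v T e * expect ρ (stringOp N s e φ) else 0) := by
  rw [dominoO_eq, expect_sum_smul]
  symm
  rw [Finset.sum_eq_single 0]
  · refine Finset.sum_congr rfl fun e _ => ?_
    by_cases h : 0 < e
    · simp [h]
    · have : windowWeight N v T e = 0 := by
        rw [windowWeight, if_neg]
        intro he
        have := Finset.mem_Icc.1 (Finset.mem_filter.1 he).1
        omega
      simp [this]
  · intro s _ hs
    simp [hs]
  · simp

lemma sum_symm_eq {n : ℕ} (f : ℕ → ℕ → ℝ) (hf : ∀ i j, f i j = f j i) :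
    ∑ i ∈ Finset.range n, ∑ j ∈ Finset.range n, f i j = ∑ i ∈ Finset.range n, f i i +
      2 * ∑ i ∈ Finset.range n, ∑ j ∈ Finset.range n, (if i < j then f i j else 0) := by
  have h1 : ∀ i ∈ Finset.range n, f i i = ∑ j ∈ Finset.range n, if i = j then f i j else 0 := by
    intro i hi
    rw [Finset.sum_ite_eq, if_pos hi]
  have h2 : ∑ i ∈ Finset.range n, ∑ j ∈ Finset.range n, (if i < j then f i j else 0) =
      ∑ i ∈ Finset.range n, ∑ j ∈ Finset.range n, (if j < i then f i j else 0) := by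
    rw [Finset.sum_comm]
    simp only [hf]
  rw [two_mul]
  nth_rewrite 2 [h2]
  rw [Finset.sum_congr rfl h1, ← Finset.sum_add_distrib, ← Finset.sum_add_distrib]
  refine Finset.sum_congr rfl fun i _ => ?_
  rw [← Finset.sum_add_distrib, ← Finset.sum_add_distrib]
  refine Finset.sum_congr rfl fun j _ => ?_
  rcases lt_trichotomy i j with h | h | h
  · simp [h, h.ne, h.not_gt]
  · simp [h]
  · simp [h, h.ne', h.not_gt]

lemma expect_dominoO_sq (ρ : ChainOp N) (hρ : expect ρ (tensorOp fun _ => 1) = 1) :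
    expect ρ (dominoO N v T φ * dominoO N v T φ) =
      ∑ i ∈ window N v T, ‖amp N T i‖ ^ 2 + 2 *
      ∑ s ∈ Finset.range (N + 1), ∑ e ∈ Finset.range (N + 1), (if s < e then
        windowWeight N v T s * windowWeight N v T e * expect ρ (stringOp N s e φ) else 0) := by
  have h1 : expect ρ (dominoO N v T φ * dominoO N v T φ) =
      ∑ s ∈ Finset.range (N + 1), ∑ e ∈ Finset.range (N + 1), windowWeight N v T s *
        windowWeight N v T e * expect ρ (stringOp N 0 s φ * stringOp N 0 e φ) := by
    rw [dominoO_eq, Finset.sum_mul]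
    simp only [Matrix.smul_mul]
    rw [expect_sum_smul]
    refine Finset.sum_congr rfl fun s _ => ?_
    simp only [Finset.mul_sum, Matrix.mul_smul]
    rw [expect_sum_smul, Finset.mul_sum]
    refine Finset.sum_congr rfl fun e _ => ?_
    ring
  refine h1.trans ((sum_symm_eq (fun s e => windowWeight N v T s * windowWeight N v T e *
    expect ρ (stringOp N 0 s φ * stringOp N 0 e φ)) fun i j => ?_).trans ?_)
  · rcases le_total i j with h | h
    · simp only [(stringOp_mul_of_le h).1, (stringOp_mul_of_le h).2]; ring
    · simp only [(stringOp_mul_of_le h).1, (stringOp_mul_of_le h).2]; ring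
  · refine congrArg₂ (· + ·) ?_ (congrArg (2 * ·) ?_)
    · refine Eq.trans (Finset.sum_congr rfl fun i _ => ?_)
        (sum_windowWeight_mul (fun _ r => r ^ 2) (by simp))
      rw [(stringOp_mul_of_le le_rfl).1, stringOp_self, hρ, mul_one, sq]
    · refine Finset.sum_congr rfl fun s _ => Finset.sum_congr rfl fun e _ => ?_
      by_cases h : s < e
      · rw [if_pos h, if_pos h, (stringOp_mul_of_le h.le).1]
      · rw [if_neg h, if_neg h]

lemma expect_sensed_stringOp (hN : 1 ≤ N) (Φ : SuperOp) (s e : ℕ) :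
    expect (tensorPower N Φ (dominoRho N T)) (stringOp N s e φ) =
      1 / 2 * (∑ k ∈ Finset.range (N + 1), ∑ l ∈ Finset.range (N + 1),
        wallAmp N T k * star (wallAmp N T l) * stringTerm N s e φ Φ k l).re :=
  expect_tensorPower_dominoRho hN T Φ (stringSite N s e φ)

lemma expect_sensed_one (hN : 1 ≤ N) {Φ : SuperOp} (hΦ : IsChannel Φ) :
    expect (tensorPower N Φ (dominoRho N T)) (tensorOp fun _ => 1) = 1 := by
  rw [expect_tensorPower_dominoRho hN]
  have h1 : ∀ k ∈ Finset.range (N + 1), ∀ l ∈ Finset.range (N + 1),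
      ∏ j : Fin N, siteTerm Φ 1 (wallConfig N k j) (wallConfig N l j) =
        if k = l then 1 else 0 := by
    intro k hk l hl
    simp only [siteTerm_one hΦ]
    split_ifs with h
    · simp [h]
    · obtain ⟨j, hj⟩ := Function.ne_iff.1 ((wallConfig_injOn N).ne hk hl h)
      exact Finset.prod_eq_zero (Finset.mem_univ j) (if_neg hj)
  have h2 : ∑ k ∈ Finset.range (N + 1), ∑ l ∈ Finset.range (N + 1),
      wallAmp N T k * star (wallAmp N T l) *
        ∏ j : Fin N, siteTerm Φ 1 (wallConfig N k j) (wallConfig N l j) =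
      ((∑ k ∈ Finset.range (N + 1), ‖wallAmp N T k‖ ^ 2 : ℝ) : ℂ) := by
    push_cast
    refine Finset.sum_congr rfl fun k hk => ?_
    rw [Finset.sum_congr rfl fun l hl => by rw [h1 k hk l hl]]
    simp only [mul_ite, mul_one, mul_zero, Finset.sum_ite_eq, if_pos hk]
    exact Complex.mul_conj' _
  rw [h2, sum_norm_sq_wallAmp hN, Complex.ofReal_re]
  norm_num

end Observable

/-! ### Mean, second moment and slope in the noisy state -/

section Signal

variable {N : ℕ} {v T θpr θ ε b : ℝ} {φ : ℕ → ℝ} {Φ D : SuperOp}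

lemma windowWeight_nonneg (i : ℕ) : 0 ≤ windowWeight N v T i := by
  unfold windowWeight
  split_ifs <;> simp

lemma mem_window_of_windowWeight_ne_zero {i : ℕ} (h : windowWeight N v T i ≠ 0) :
    i ∈ window N v T := by
  by_contra hi
  exact h (if_neg hi)

lemma mem_window {i : ℕ} : i ∈ window N v T ↔
    (1 ≤ i ∧ i ≤ N) ∧ v * T / 2 ≤ (i : ℝ) ∧ (i : ℝ) ≤ 2 * v * T := by
  rw [window, Finset.mem_filter, Finset.mem_Icc]

lemma sum_window_le_one (hN : 1 ≤ N) : ∑ i ∈ window N v T, ‖amp N T i‖ ^ 2 ≤ 1 := by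
  rw [← sum_norm_sq_amp hN T]
  exact Finset.sum_le_sum_of_subset_of_nonneg (Finset.filter_subset _ _)
    fun _ _ _ => by positivity

lemma sum_windowWeight_sq_le (hN : 1 ≤ N) :
    ∑ i ∈ Finset.range (N + 1), windowWeight N v T i ^ 2 ≤ 1 := by
  rw [sum_windowWeight_mul (fun _ r => r ^ 2) (by simp)]
  exact sum_window_le_one hN

lemma norm_wallAmp_of_mem {i : ℕ} (hi : i ∈ window N v T) : ‖wallAmp N T i‖ = ‖amp N T i‖ := by
  have := (mem_window.1 hi).1.1
  rw [wallAmp, if_neg (by omega)]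

lemma sum_windowWeight_mul_wallAmp_le (hN : 1 ≤ N) :
    ∑ i ∈ Finset.range (N + 1), windowWeight N v T i * ‖wallAmp N T i‖ ≤ 1 := by
  rw [sum_windowWeight_mul (fun i r => r * ‖wallAmp N T i‖) (by simp)]
  refine le_trans (le_of_eq ?_) (sum_window_le_one hN (v := v) (T := T))
  refine Finset.sum_congr rfl fun i hi => ?_
  rw [norm_wallAmp_of_mem hi, sq]

/-- Noise of strength `O(1/(vT))` accumulates to `exp ε` over a string of at most `2vT` sites. -/
lemma one_add_pow_le (hb : 0 ≤ b) (hε : 4 * b * (2 * v * T) ≤ ε) (hε1 : ε ≤ 1) {m : ℕ}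
    (hm : (m : ℝ) ≤ 2 * v * T) : (1 + 4 * b) ^ m ≤ 1 + 2 * ε := by
  have h1 : (m : ℝ) * (4 * b) ≤ ε := by nlinarith
  have hε0 : 0 ≤ ε := le_trans (by positivity) h1
  calc (1 + 4 * b) ^ m ≤ (Real.exp (4 * b)) ^ m := by
        gcongr
        linarith [Real.add_one_le_exp (4 * b)]
    _ = Real.exp (m * (4 * b)) := by rw [← Real.exp_nat_mul]
    _ ≤ Real.exp ε := Real.exp_le_exp.2 h1
    _ ≤ 1 + 2 * ε := by
        have := Real.abs_exp_sub_one_le (x := ε) (by rw [abs_of_nonneg hε0]; exact hε1)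
        rw [abs_of_nonneg hε0] at this
        linarith [le_abs_self (Real.exp ε - 1)]

lemma abs_re_mul_sub_le {z P H : ℂ} {r q ζ : ℝ} (hz : ‖z‖ = r) (hq : (z * H).re = r * q)
    (h : ‖P - H‖ ≤ ζ) : |(z * P).re - r * q| ≤ r * ζ := by
  rw [← hq, ← Complex.sub_re, ← mul_sub]
  refine (Complex.abs_re_le_norm _).trans ?_
  rw [norm_mul, hz]
  exact mul_le_mul_of_nonneg_left h (hz ▸ norm_nonneg z)

lemma re_ofReal_mul_exp (r x : ℝ) :
    ((r : ℂ) * Complex.exp ((x : ℂ) * Complex.I)).re = r * Real.cos x := by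
  rw [Complex.re_ofReal_mul, Complex.exp_ofReal_mul_I_re]

lemma re_ofReal_mul_I_mul_exp (m r x : ℝ) :
    ((m : ℂ) * Complex.I * ((r : ℂ) * Complex.exp ((x : ℂ) * Complex.I))).re =
      r * (-m * Real.sin x) := by
  have : (m : ℂ) * Complex.I * ((r : ℂ) * Complex.exp ((x : ℂ) * Complex.I)) =
      ((m * r : ℝ) : ℂ) * (Complex.I * Complex.exp ((x : ℂ) * Complex.I)) := by
    push_cast; ring
  rw [this, Complex.re_ofReal_mul, Complex.I_mul_re, Complex.exp_ofReal_mul_I_im]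
  ring

/-- Weighted sums of string expectation values are close to their noiseless values. -/
lemma abs_sum_stringTerm_sub_le (hN : 1 ≤ N) (hb : 0 ≤ b) (hε : 4 * b * (2 * v * T) ≤ ε)
    (hbε : 4 * b ≤ ε) (hε1 : ε ≤ 1 / 2) (hΦ : IsChannel Φ)
    (h : diamondNorm (Φ - idealSensing θ) ≤ ENNReal.ofReal b) (hφ : IsAligned N T θpr φ)
    {x : ℕ → ℝ} (hx : ∀ i, 0 ≤ x i) (hx1 : ∑ i ∈ Finset.range (N + 1), x i ^ 2 ≤ 1)
    (hxα : ∑ i ∈ Finset.range (N + 1), x i * ‖wallAmp N T i‖ ≤ 1) :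
    |∑ s ∈ Finset.range (N + 1), ∑ e ∈ Finset.range (N + 1), (if s < e then
        x s * windowWeight N v T e * (1 / 2 * (∑ k ∈ Finset.range (N + 1),
          ∑ l ∈ Finset.range (N + 1),
          wallAmp N T k * star (wallAmp N T l) * stringTerm N s e φ Φ k l).re) else 0) -
      ∑ s ∈ Finset.range (N + 1), ∑ e ∈ Finset.range (N + 1), (if s < e then
        x s * windowWeight N v T e * (‖wallAmp N T s‖ * ‖wallAmp N T e‖ *
          Real.cos (signalPhase θpr θ s e)) else 0)| ≤ 42 * ε := by
  have hlen : ∀ s e : ℕ, windowWeight N v T e ≠ 0 → ((e - s : ℕ) : ℝ) ≤ 2 * v * T := by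
    intro s e he
    have h1 := (mem_window.1 (mem_window_of_windowWeight_ne_zero he)).2.2
    exact (Nat.cast_le.2 (Nat.sub_le e s)).trans h1
  -- Both constants come from `(1 + 4b)^(e-s) ≤ 1 + 2ε ≤ 2`, and `20 * 2 * 4b + 2ε ≤ 42ε`.
  refine (abs_weighted_sum_sub_le (δ := 4 * b) (C := 2) (ζ := 2 * ε)
    (α := wallAmp N T) (P := fun s e k l => stringTerm N s e φ Φ k l)
    (q := fun s e => Real.cos (signalPhase θpr θ s e)) (by positivity) (by linarith)
    (by norm_num) (by linarith) hx windowWeight_nonneg hx1 (sum_windowWeight_sq_le hN)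
    (sum_norm_sq_wallAmp hN T).le hxα (sum_windowWeight_mul_wallAmp_le hN) ?_ ?_).trans
    (by linarith)
  · intro s e k l hse he hk hl hye
    refine (norm_stringTerm_le hΦ hb h (by omega) (by omega) (by omega)).trans ?_
    have := one_add_pow_le hb hε (by linarith) (hlen s e hye)
    exact mul_le_mul_of_nonneg_right (by linarith) (stringWeight_nonneg (by positivity) _ _ _ _)
  · intro s e hse he _ hye
    have hpow := one_add_pow_le hb hε (by linarith) (hlen s e hye)
    obtain ⟨m1, m2⟩ := hφ.mul_prod_idealSite θ hse (by omega)
    constructor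
    · refine abs_re_mul_sub_le (by rw [norm_mul, norm_star])
        (H := ∏ j : Fin N, idealSite N s e φ θ s e j) ?_
        ((norm_stringTerm_sub_ideal_le hΦ hb h hse (by omega) (Or.inr ⟨rfl, rfl⟩)).trans
          (by linarith))
      rw [m2, re_ofReal_mul_exp, Real.cos_neg]
    · refine abs_re_mul_sub_le (by rw [norm_mul, norm_star, mul_comm])
        (H := ∏ j : Fin N, idealSite N s e φ θ e s j) ?_
        ((norm_stringTerm_sub_ideal_le hΦ hb h hse (by omega) (Or.inl ⟨rfl, rfl⟩)).trans
          (by linarith))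
      rw [m1, re_ofReal_mul_exp]

lemma abs_sum_stringDeriv_sub_le (hN : 1 ≤ N) (hb : 0 ≤ b) (hvT : 0 ≤ 2 * v * T)
    (hε : 4 * b * (2 * v * T) ≤ ε)
    (hbε : 4 * b ≤ ε) (hε1 : ε ≤ 1 / 2) (hΦ : IsChannel Φ)
    (h : diamondNorm (Φ - idealSensing θ) ≤ ENNReal.ofReal b)
    (hD : diamondNorm D ≤ ENNReal.ofReal b) (hφ : IsAligned N T θpr φ)
    {x : ℕ → ℝ} (hx : ∀ i, 0 ≤ x i) (hx1 : ∑ i ∈ Finset.range (N + 1), x i ^ 2 ≤ 1)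
    (hxα : ∑ i ∈ Finset.range (N + 1), x i * ‖wallAmp N T i‖ ≤ 1) :
    |∑ s ∈ Finset.range (N + 1), ∑ e ∈ Finset.range (N + 1), (if s < e then
        x s * windowWeight N v T e * (1 / 2 * (∑ k ∈ Finset.range (N + 1),
          ∑ l ∈ Finset.range (N + 1),
          wallAmp N T k * star (wallAmp N T l) * stringDeriv N s e φ Φ D θ k l).re) else 0) -
      ∑ s ∈ Finset.range (N + 1), ∑ e ∈ Finset.range (N + 1), (if s < e then
        x s * windowWeight N v T e * (‖wallAmp N T s‖ * ‖wallAmp N T e‖ *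
          (-(2 * ((e - s : ℕ) : ℝ)) * Real.sin (signalPhase θpr θ s e))) else 0)| ≤
      252 * (v * T) * ε := by
  have hlen : ∀ s e : ℕ, windowWeight N v T e ≠ 0 → ((e - s : ℕ) : ℝ) ≤ 2 * v * T := by
    intro s e he
    have h1 := (mem_window.1 (mem_window_of_windowWeight_ne_zero he)).2.2
    exact (Nat.cast_le.2 (Nat.sub_le e s)).trans h1
  have hε0 : 0 ≤ ε := by linarith
  -- The length `2vT` enters once through the Leibniz rule; the total `240 + 12 = 252` multiplies
  -- `vT ε`.
  refine (abs_weighted_sum_sub_le (δ := 4 * b) (C := 6 * (2 * v * T)) (ζ := 6 * ε * (2 * v * T))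
    (α := wallAmp N T) (P := fun s e k l => stringDeriv N s e φ Φ D θ k l)
    (q := fun s e => -(2 * ((e - s : ℕ) : ℝ)) * Real.sin (signalPhase θpr θ s e)) (by positivity)
    (by linarith) (by positivity) (by positivity) hx windowWeight_nonneg hx1
    (sum_windowWeight_sq_le hN)
    (sum_norm_sq_wallAmp hN T).le hxα (sum_windowWeight_mul_wallAmp_le hN) ?_ ?_).trans
    (by nlinarith)
  · intro s e k l hse he hk hl hye
    refine (norm_stringDeriv_le hΦ hb h hD (by omega) (by omega) (by omega)).trans ?_
    have hpow := one_add_pow_le hb hε (by linarith) (hlen s e hye)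
    have hl := hlen s e hye
    have hw := stringWeight_nonneg (show 0 ≤ 4 * b by positivity) s e k l
    have h2 : (1 + 4 * b) ^ (e - s) * stringWeight (4 * b) s e k l ≤
        2 * stringWeight (4 * b) s e k l := mul_le_mul_of_nonneg_right (by linarith) hw
    calc _ ≤ 3 * (2 * v * T) * (2 * stringWeight (4 * b) s e k l) := by gcongr
      _ = _ := by ring
  · intro s e hse he _ hye
    have hpow := one_add_pow_le hb hε (by linarith) (hlen s e hye)
    have hl := hlen s e hye
    have hone : 1 ≤ (1 + 4 * b) ^ (e - s) := one_le_pow₀ (by linarith)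
    have hζ : ((e - s : ℕ) : ℝ) * (4 * b * (1 + 4 * b) ^ (e - s) +
        2 * ((1 + 4 * b) ^ (e - s) - 1)) ≤ 6 * ε * (2 * v * T) := by
      have : 4 * b * (1 + 4 * b) ^ (e - s) + 2 * ((1 + 4 * b) ^ (e - s) - 1) ≤ 6 * ε := by
        nlinarith
      calc _ ≤ (2 * v * T) * (6 * ε) := by gcongr
        _ = _ := by ring
    obtain ⟨m1, m2⟩ := hφ.mul_prod_idealSite θ hse (by omega)
    constructor
    · refine abs_re_mul_sub_le (by rw [norm_mul, norm_star]) ?_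
        ((norm_stringDeriv_sub_ideal_le hΦ hb h hD hse (by omega) (Or.inr ⟨rfl, rfl⟩)).trans hζ)
      rw [mul_left_comm, m2, if_neg hse.ne, show ((e - s : ℕ) : ℂ) * (-1 * 2 * Complex.I) =
        ((-(2 * ((e - s : ℕ) : ℝ)) : ℝ) : ℂ) * Complex.I by push_cast; ring,
        re_ofReal_mul_I_mul_exp, Real.sin_neg]
      ring
    · refine abs_re_mul_sub_le (by rw [norm_mul, norm_star, mul_comm]) ?_
        ((norm_stringDeriv_sub_ideal_le hΦ hb h hD hse (by omega) (Or.inl ⟨rfl, rfl⟩)).trans hζ)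
      rw [mul_left_comm, m1, if_pos rfl, show ((e - s : ℕ) : ℂ) * (1 * 2 * Complex.I) =
        ((2 * ((e - s : ℕ) : ℝ) : ℝ) : ℂ) * Complex.I by push_cast; ring,
        re_ofReal_mul_I_mul_exp]

lemma sum_origin_eq (q : ℕ → ℕ → ℝ) :
    ∑ s ∈ Finset.range (N + 1), ∑ e ∈ Finset.range (N + 1), (if s < e then
        (if s = 0 then 1 else 0) * windowWeight N v T e *
          (‖wallAmp N T s‖ * ‖wallAmp N T e‖ * q s e) else 0) =
      ∑ e ∈ window N v T, ‖amp N T e‖ ^ 2 * q 0 e := by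
  rw [Finset.sum_eq_single 0]
  · refine Eq.trans (Finset.sum_congr rfl fun e _ => ?_)
      ((sum_windowWeight_mul (fun e r => r * ‖wallAmp N T e‖ * q 0 e) (by simp)).trans
        (Finset.sum_congr rfl fun e he => ?_))
    · by_cases h : 0 < e
      · have h0 : ‖wallAmp N T 0‖ = 1 := by simp [wallAmp]
        rw [if_pos h, if_pos rfl, h0]
        ring
      · have : windowWeight N v T e = 0 := by
          by_contra hne
          have := (mem_window.1 (mem_window_of_windowWeight_ne_zero hne)).1.1
          omega
        rw [if_neg h, this]
        ring
    · rw [norm_wallAmp_of_mem he, sq]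
  · intro s _ hs
    simp [hs]
  · simp

lemma sum_origin_sq_le : ∑ i ∈ Finset.range (N + 1), (if i = 0 then (1 : ℝ) else 0) ^ 2 ≤ 1 := by
  simp

lemma sum_origin_mul_wallAmp_le :
    ∑ i ∈ Finset.range (N + 1), (if i = 0 then (1 : ℝ) else 0) * ‖wallAmp N T i‖ ≤ 1 := by
  simp [wallAmp]

/-- The expectation value of the observable in the noisy state. -/
lemma abs_expect_dominoO_sub_le (hN : 1 ≤ N) (hb : 0 ≤ b) (hε : 4 * b * (2 * v * T) ≤ ε)
    (hbε : 4 * b ≤ ε) (hε1 : ε ≤ 1 / 2) (hΦ : IsChannel Φ)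
    (h : diamondNorm (Φ - idealSensing θ) ≤ ENNReal.ofReal b) (hφ : IsAligned N T θpr φ) :
    |expect (tensorPower N Φ (dominoRho N T)) (dominoO N v T φ) -
      ∑ e ∈ window N v T, ‖amp N T e‖ ^ 2 * Real.sin (2 * (θ - θpr) * e)| ≤ 42 * ε := by
  have key := abs_sum_stringTerm_sub_le hN hb hε hbε hε1 hΦ h hφ
    (x := fun s => if s = 0 then 1 else 0) (fun i => by split_ifs <;> norm_num)
    sum_origin_sq_le sum_origin_mul_wallAmp_le
  rw [sum_origin_eq] at key
  simp only [← expect_sensed_stringOp hN] at key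
  rw [← expect_dominoO] at key
  simpa [signalPhase, Real.cos_sub_pi_div_two] using key

/-- The second moment of the observable in the noisy state. -/
lemma abs_expect_dominoO_sq_sub_le (hN : 1 ≤ N) (hb : 0 ≤ b) (hε : 4 * b * (2 * v * T) ≤ ε)
    (hbε : 4 * b ≤ ε) (hε1 : ε ≤ 1 / 2) (hΦ : IsChannel Φ)
    (h : diamondNorm (Φ - idealSensing θ) ≤ ENNReal.ofReal b) (hφ : IsAligned N T θpr φ) :
    |expect (tensorPower N Φ (dominoRho N T)) (dominoO N v T φ * dominoO N v T φ) -
      (∑ i ∈ window N v T, ‖amp N T i‖ ^ 2 +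
        2 * ∑ s ∈ Finset.range (N + 1), ∑ e ∈ Finset.range (N + 1), (if s < e then
          windowWeight N v T s * windowWeight N v T e * (‖wallAmp N T s‖ * ‖wallAmp N T e‖ *
            Real.cos (signalPhase θpr θ s e)) else 0))| ≤ 84 * ε := by
  have key := abs_sum_stringTerm_sub_le hN hb hε hbε hε1 hΦ h hφ
    (x := windowWeight N v T) windowWeight_nonneg (sum_windowWeight_sq_le hN)
    (sum_windowWeight_mul_wallAmp_le hN)
  simp only [← expect_sensed_stringOp hN] at key
  rw [expect_dominoO_sq _ (expect_sensed_one hN hΦ)]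
  rw [abs_le] at key ⊢
  constructor <;> linarith [key.1, key.2]

lemma hasDerivAt_expect_dominoO (hN : 1 ≤ N) {Ψ : ℝ → SuperOp} (hΨ : ∀ t, IsChannel (Ψ t))
    (hD : HasSuperDerivAt (fun t => Ψ t - idealSensing t) D θ) :
    HasDerivAt (fun t => expect (tensorPower N (Ψ t) (dominoRho N T)) (dominoO N v T φ))
      (∑ s ∈ Finset.range (N + 1), ∑ e ∈ Finset.range (N + 1), (if s < e then
        (if s = 0 then 1 else 0) * windowWeight N v T e * (1 / 2 * (∑ k ∈ Finset.range (N + 1),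
          ∑ l ∈ Finset.range (N + 1),
          wallAmp N T k * star (wallAmp N T l) * stringDeriv N s e φ (Ψ θ) D θ k l).re) else 0))
      θ := by
  simp only [expect_dominoO, expect_sensed_stringOp hN]
  refine HasDerivAt.fun_sum fun s _ => HasDerivAt.fun_sum fun e _ => ?_
  split_ifs
  · refine HasDerivAt.const_mul _ (HasDerivAt.const_mul _ ?_)
    refine Complex.reCLM.hasFDerivAt.comp_hasDerivAt θ (HasDerivAt.fun_sum fun k _ =>
      HasDerivAt.fun_sum fun l _ => (hasDerivAt_stringTerm hΨ hD k l).const_mul _)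
  · refine HasDerivAt.const_mul _ (HasDerivAt.const_mul _ ?_)
    refine Complex.reCLM.hasFDerivAt.comp_hasDerivAt θ (HasDerivAt.fun_sum fun k _ =>
      HasDerivAt.fun_sum fun l _ => (hasDerivAt_stringTerm hΨ hD k l).const_mul _)
  · exact hasDerivAt_const _ _

/-- The slope of the expectation value of the observable in the noisy state. -/
lemma exists_hasDerivAt_expect_dominoO (hN : 1 ≤ N) (hb : 0 ≤ b) (hvT : 0 ≤ 2 * v * T)
    (hε : 4 * b * (2 * v * T) ≤ ε)
    (hbε : 4 * b ≤ ε) (hε1 : ε ≤ 1 / 2) {Ψ : ℝ → SuperOp} (hΨ : ∀ t, IsChannel (Ψ t))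
    (h : diamondNorm (Ψ θ - idealSensing θ) ≤ ENNReal.ofReal b)
    (hD : HasSuperDerivAt (fun t => Ψ t - idealSensing t) D θ)
    (hDb : diamondNorm D ≤ ENNReal.ofReal b) (hφ : IsAligned N T θpr φ) :
    ∃ d : ℝ,
      HasDerivAt (fun t => expect (tensorPower N (Ψ t) (dominoRho N T)) (dominoO N v T φ)) d θ ∧
      |d - ∑ e ∈ window N v T, ‖amp N T e‖ ^ 2 * (2 * e * Real.cos (2 * (θ - θpr) * e))| ≤
        252 * (v * T) * ε := by
  refine ⟨_, hasDerivAt_expect_dominoO hN hΨ hD, ?_⟩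
  have key := abs_sum_stringDeriv_sub_le hN hb hvT hε hbε hε1 (hΨ θ) h hDb hφ
    (x := fun s => if s = 0 then 1 else 0) (fun i => by split_ifs <;> norm_num)
    sum_origin_sq_le sum_origin_mul_wallAmp_le
  rw [sum_origin_eq] at key
  simpa [signalPhase, Real.sin_sub_pi_div_two] using key

end Signal

/-! ### Bounds for the noiseless sums -/

section WallCorrelations

variable {N : ℕ} {v T θpr θ : ℝ}

lemma sum_wall_correlations_le (hN : 1 ≤ N) :
    ∑ s ∈ Finset.range (N + 1), ∑ e ∈ Finset.range (N + 1), (if s < e then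
      windowWeight N v T s * windowWeight N v T e * (‖wallAmp N T s‖ * ‖wallAmp N T e‖ *
        Real.cos (signalPhase θpr θ s e)) else 0) ≤ 1 := by
  have h1 := sum_windowWeight_mul_wallAmp_le (v := v) (T := T) hN
  have h0 : ∀ i, 0 ≤ windowWeight N v T i * ‖wallAmp N T i‖ := fun i =>
    mul_nonneg (windowWeight_nonneg i) (norm_nonneg _)
  calc _ ≤ ∑ s ∈ Finset.range (N + 1), ∑ e ∈ Finset.range (N + 1),
        (windowWeight N v T s * ‖wallAmp N T s‖) * (windowWeight N v T e * ‖wallAmp N T e‖) := by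
        refine Finset.sum_le_sum fun s _ => Finset.sum_le_sum fun e _ => ?_
        have h2 := mul_nonneg (h0 s) (h0 e)
        split_ifs
        · calc _ = (windowWeight N v T s * ‖wallAmp N T s‖) *
                (windowWeight N v T e * ‖wallAmp N T e‖) * Real.cos (signalPhase θpr θ s e) := by
                ring
            _ ≤ _ := mul_le_of_le_one_right h2 (Real.cos_le_one _)
        · exact h2
    _ = (∑ s ∈ Finset.range (N + 1), windowWeight N v T s * ‖wallAmp N T s‖) *
        ∑ e ∈ Finset.range (N + 1), windowWeight N v T e * ‖wallAmp N T e‖ :=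
        (Finset.sum_mul_sum _ _ _ _).symm
    _ ≤ 1 := mul_le_one₀ h1 (Finset.sum_nonneg fun i _ => h0 i) h1

/-- Window walls have `s ≥ 1`, so no `π/2` shift occurs, and the angles are at most `1 < π/2`. This
sign keeps the second moment above `∑ |a_i|²` up to noise. -/
lemma sum_wall_correlations_nonneg (h : 4 * (|θ - θpr| * (v * T)) ≤ 1) :
    0 ≤ ∑ s ∈ Finset.range (N + 1), ∑ e ∈ Finset.range (N + 1), (if s < e then
      windowWeight N v T s * windowWeight N v T e * (‖wallAmp N T s‖ * ‖wallAmp N T e‖ *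
        Real.cos (signalPhase θpr θ s e)) else 0) := by
  refine Finset.sum_nonneg fun s _ => Finset.sum_nonneg fun e _ => ?_
  split_ifs with hse
  · by_cases hs : windowWeight N v T s = 0
    · simp [hs]
    by_cases he : windowWeight N v T e = 0
    · simp [he]
    have hs1 := (mem_window.1 (mem_window_of_windowWeight_ne_zero hs)).1.1
    have he1 := (mem_window.1 (mem_window_of_windowWeight_ne_zero he)).2.2
    have hcos : 0 ≤ Real.cos (signalPhase θpr θ s e) := by
      have hse' : (s : ℝ) ≤ e := Nat.cast_le.2 hse.le
      have h1 : |signalPhase θpr θ s e| ≤ 1 := by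
        rw [signalPhase, if_neg (by omega), sub_zero, abs_mul, abs_mul, abs_two,
          abs_of_nonneg (sub_nonneg.2 hse')]
        have : (e : ℝ) - s ≤ 2 * v * T := by linarith [Nat.cast_nonneg (α := ℝ) s]
        nlinarith [abs_nonneg (θ - θpr), mul_le_mul_of_nonneg_left this (abs_nonneg (θ - θpr))]
      rw [abs_le] at h1
      have := Real.pi_gt_three
      exact Real.cos_nonneg_of_neg_pi_div_two_le_of_le (by linarith) (by linarith)
    have := windowWeight_nonneg (N := N) (v := v) (T := T) s
    have := windowWeight_nonneg (N := N) (v := v) (T := T) e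
    positivity
  · exact le_rfl

lemma abs_signal_angle_le {x : ℝ} (h : |θ - θpr| * (v * T) ≤ x) {e : ℕ}
    (he : e ∈ window N v T) : |2 * (θ - θpr) * e| ≤ 4 * x := by
  have he1 := (mem_window.1 he).2.2
  rw [abs_mul, abs_mul, abs_two, Nat.abs_cast]
  nlinarith [mul_le_mul_of_nonneg_left he1 (abs_nonneg (θ - θpr))]

lemma abs_sum_sin_le (hN : 1 ≤ N) {x : ℝ} (hx : 0 ≤ x) (h : |θ - θpr| * (v * T) ≤ x) :
    |∑ e ∈ window N v T, ‖amp N T e‖ ^ 2 * Real.sin (2 * (θ - θpr) * e)| ≤ 4 * x := by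
  calc _ ≤ ∑ e ∈ window N v T, ‖amp N T e‖ ^ 2 * (4 * x) := by
        refine (Finset.abs_sum_le_sum_abs _ _).trans (Finset.sum_le_sum fun e he => ?_)
        rw [abs_mul, abs_of_nonneg (by positivity)]
        gcongr
        exact (Real.abs_sin_le_abs).trans (abs_signal_angle_le h he)
    _ = (∑ e ∈ window N v T, ‖amp N T e‖ ^ 2) * (4 * x) := (Finset.sum_mul _ _ _).symm
    _ ≤ 1 * (4 * x) := by gcongr; exact sum_window_le_one hN
    _ = 4 * x := one_mul _

/-- Both ends of the window are used: `e ≥ vT/2` with cosine at least `1/2` below, `e ≤ 2vT` above.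
-/
lemma sum_slope_bounds (hN : 1 ≤ N) (hvT : 0 ≤ v * T) (h : 4 * (|θ - θpr| * (v * T)) ≤ 1) :
    v * T / 2 * ∑ e ∈ window N v T, ‖amp N T e‖ ^ 2 ≤
      ∑ e ∈ window N v T, ‖amp N T e‖ ^ 2 * (2 * e * Real.cos (2 * (θ - θpr) * e)) ∧
    ∑ e ∈ window N v T, ‖amp N T e‖ ^ 2 * (2 * e * Real.cos (2 * (θ - θpr) * e)) ≤
      4 * (v * T) := by
  constructor
  · rw [Finset.mul_sum]
    refine Finset.sum_le_sum fun e he => ?_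
    have hang := abs_signal_angle_le (θ := θ) (θpr := θpr) le_rfl he
    have hcos : 1 / 2 ≤ Real.cos (2 * (θ - θpr) * e) := by
      have h1 := Real.one_sub_sq_div_two_le_cos (x := 2 * (θ - θpr) * e)
      have h2 : (2 * (θ - θpr) * e) ^ 2 ≤ 1 := (sq_le_one_iff_abs_le_one _).2 (by linarith)
      linarith
    have he1 := (mem_window.1 he).2.1
    rw [mul_comm]
    gcongr
    nlinarith
  · calc _ ≤ ∑ e ∈ window N v T, ‖amp N T e‖ ^ 2 * (4 * (v * T)) := by
          refine Finset.sum_le_sum fun e he => ?_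
          have he1 := (mem_window.1 he).2.2
          refine mul_le_mul_of_nonneg_left ?_ (by positivity)
          calc 2 * (e : ℝ) * Real.cos (2 * (θ - θpr) * e) ≤ 2 * (e : ℝ) :=
                mul_le_of_le_one_right (by positivity) (Real.cos_le_one _)
            _ ≤ _ := by linarith
      _ = (∑ e ∈ window N v T, ‖amp N T e‖ ^ 2) * (4 * (v * T)) := (Finset.sum_mul _ _ _).symm
      _ ≤ 1 * (4 * (v * T)) := by gcongr; exact sum_window_le_one hN
      _ = _ := one_mul _

end WallCorrelations

end DominoMetrology

/-! ### Choice of constants and conclusion -/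

theorem theorem3 (v c K : ℝ) (hv : 0 < v) (hc : 0 < c) (hK : 0 < K) :
    ∃ cno cpr c₁ c₂ : ℝ, 0 < cno ∧ 0 < cpr ∧ 0 < c₁ ∧ 0 < c₂ ∧
      ∀ (N : ℕ) (T p θpr θ : ℝ) (𝒩 : ℝ → SuperOp),
        0 < T → 0 ≤ p → p ≤ cno / (v * T) →
        IsNoisySensing K p 𝒩 →
        c ≤ ∑ i ∈ window N v T, ‖amp N T i‖ ^ 2 →
        |θ - θpr| ≤ cpr / (v * T) →
        (∃ φ : ℕ → ℝ, IsAligned N T θpr φ) ∧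
        ∀ φ : ℕ → ℝ, IsAligned N T θpr φ →
          DifferentiableAt ℝ (fun t => expect (sensedRho N T 𝒩 t) (dominoO N v T φ)) θ ∧
          0 < variance (sensedRho N T 𝒩 θ) (dominoO N v T φ) ∧
          c₁ * T ^ 2 ≤ sensitivity (sensedRho N T 𝒩) (dominoO N v T φ) θ ∧
          sensitivity (sensedRho N T 𝒩) (dominoO N v T φ) θ ≤ c₂ * T ^ 2 := by
  have hm0 : 0 < min c 1 := lt_min hc one_pos
  have hmc : min c 1 ≤ c := min_le_left _ _
  have hm1 : min c 1 ≤ 1 := min_le_right _ _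
  set m := min c 1
  -- With `ε = m/2016` the slope error `252 vT ε` is `vT m/8`, leaving a slope between `vT c/4` and
  -- `5vT`. The mean is at most `m/4 + m/48 ≤ m/3`, so the variance lies between `c/2` and `4`. The
  -- quotients give `(c/4)²/4 = c²/64` and `25/(c/2) = 50/c`, times `v²`.
  refine ⟨m / 2016 / (8 * K), m / 16, c ^ 2 * v ^ 2 / 64, 50 * v ^ 2 / c, by positivity,
    by positivity, by positivity, by positivity, ?_⟩
  intro N T p θpr θ 𝒩 hT hp hpc hnoise hS hθ
  refine ⟨exists_isAligned N T θpr, fun φ hφ => ?_⟩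
  have hvT : 0 < v * T := mul_pos hv hT
  -- A nonempty window forces `1 ≤ N` and `1 ≤ 2vT`; the latter bounds the noise on a single site by
  -- `ε` too.
  obtain ⟨i, hi⟩ : (window N v T).Nonempty := by
    by_contra hne
    rw [Finset.not_nonempty_iff_eq_empty.1 hne, Finset.sum_empty] at hS
    linarith
  obtain ⟨⟨hi1, hiN⟩, -, hi2⟩ := mem_window.1 hi
  have hN : 1 ≤ N := hi1.trans hiN
  have hlen : 1 ≤ 2 * v * T := (Nat.one_le_cast.2 hi1).trans hi2
  have hθ' : |θ - θpr| * (v * T) ≤ m / 16 := (le_div_iff₀ hvT).1 hθ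
  have hp' : p * (v * T) ≤ m / 2016 / (8 * K) := (le_div_iff₀ hvT).1 hpc
  have hb : 0 ≤ K * p := by positivity
  have hε : 4 * (K * p) * (2 * v * T) ≤ m / 2016 := by
    rw [le_div_iff₀ (by positivity)] at hp'
    linarith
  have hbε : 4 * (K * p) ≤ m / 2016 :=
    (le_mul_of_one_le_right (by positivity) hlen).trans hε
  have hε1 : m / 2016 ≤ 1 / 2 := by linarith
  have h4 : 4 * (|θ - θpr| * (v * T)) ≤ 1 := by linarith
  obtain ⟨D, hD, hDb⟩ := hnoise.deriv_close θ
  obtain ⟨d, hd, hdM⟩ := exists_hasDerivAt_expect_dominoO hN hb (by linarith) hε hbε hε1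
    hnoise.channel (hnoise.close θ) hD hDb hφ
  obtain ⟨hM1, hM2⟩ := sum_slope_bounds (N := N) (θ := θ) (θpr := θpr) hN hvT.le h4
  have hmean := abs_expect_dominoO_sub_le hN hb hε hbε hε1 (hnoise.channel θ) (hnoise.close θ) hφ
  have hsq := abs_expect_dominoO_sq_sub_le hN hb hε hbε hε1 (hnoise.channel θ) (hnoise.close θ) hφ
  have hsin := abs_sum_sin_le (N := N) (θ := θ) (θpr := θpr) hN (by positivity) hθ'
  have hcor1 := sum_wall_correlations_le (N := N) (v := v) (T := T) (θ := θ) (θpr := θpr) hN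
  have hcor0 := sum_wall_correlations_nonneg (N := N) h4
  have hS1 := sum_window_le_one (v := v) (T := T) hN
  change HasDerivAt (fun t => expect (sensedRho N T 𝒩 t) (dominoO N v T φ)) d θ at hd
  change |expect (sensedRho N T 𝒩 θ) (dominoO N v T φ) - _| ≤ _ at hmean
  change |expect (sensedRho N T 𝒩 θ) (dominoO N v T φ * dominoO N v T φ) - _| ≤ _ at hsq
  have hmean2 : expect (sensedRho N T 𝒩 θ) (dominoO N v T φ) ^ 2 ≤ m / 9 := by
    rw [abs_le] at hmean hsin
    have h3 : expect (sensedRho N T 𝒩 θ) (dominoO N v T φ) ^ 2 ≤ (m / 3) ^ 2 :=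
      sq_le_sq' (by linarith [hmean.1, hsin.1]) (by linarith [hmean.2, hsin.2])
    nlinarith
  have hvar1 : c / 2 ≤ variance (sensedRho N T 𝒩 θ) (dominoO N v T φ) := by
    rw [abs_le] at hsq
    rw [variance]
    linarith [hsq.1]
  have hvar2 : variance (sensedRho N T 𝒩 θ) (dominoO N v T φ) ≤ 4 := by
    rw [abs_le] at hsq
    rw [variance]
    linarith [hsq.2, sq_nonneg (expect (sensedRho N T 𝒩 θ) (dominoO N v T φ))]
  have hvar0 : 0 < variance (sensedRho N T 𝒩 θ) (dominoO N v T φ) := by linarith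
  have herr : 252 * (v * T) * (m / 2016) ≤ v * T * (c / 8) := by nlinarith
  have herr' : 252 * (v * T) * (m / 2016) ≤ v * T := by nlinarith
  have hMc : v * T / 2 * c ≤ v * T / 2 * ∑ e ∈ window N v T, ‖amp N T e‖ ^ 2 := by gcongr
  rw [abs_le] at hdM
  have hd1 : v * T * (c / 4) ≤ d := by nlinarith [hdM.1]
  have hd2 : d ≤ 5 * (v * T) := by linarith [hdM.2]
  have hd0 : 0 ≤ v * T * (c / 4) := by positivity
  refine ⟨hd.differentiableAt, hvar0, ?_, ?_⟩
  · rw [sensitivity, hd.deriv, le_div_iff₀ hvar0]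
    calc c ^ 2 * v ^ 2 / 64 * T ^ 2 * variance (sensedRho N T 𝒩 θ) (dominoO N v T φ)
        ≤ c ^ 2 * v ^ 2 / 64 * T ^ 2 * 4 := by gcongr
      _ = (v * T * (c / 4)) ^ 2 := by ring
      _ ≤ d ^ 2 := by gcongr
  · rw [sensitivity, hd.deriv, div_le_iff₀ hvar0]
    calc d ^ 2 ≤ (5 * (v * T)) ^ 2 := by gcongr; linarith
      _ = 50 * v ^ 2 / c * T ^ 2 * (c / 2) := by field_simp; ring
      _ ≤ _ := by gcongr
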